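/- Fix $\omega_0>1$. For $h>0$ let $\mathbb{H}_h=\{\omega\in\mathbb{C}:\operatorname{Im}\omega>-h\}$, and let $\mathcal{K}_h$ be the class of analytic functions $f:\mathbb{H}_h\to\mathbb{C}$ such that (S) $\overline{f(\omega)}=f(-\overline{\omega})$ for $\omega\in\mathbb{H}_h$; (P) $\operatorname{Im}f(\omega)>0$ whenever $\operatorname{Im}\omega>-h$ and $\operatorname{Re}\omega>0$; (L) for some $A>0$, $f(\omega)=-A\omega^{-2}+O(\omega^{-3})$ as $\omega\to\infty$ in $\mathbb{H}_h$. Every $f\in\mathcal{K}_h$ has a unique spectral measure $\sigma_f$, that is, a finite positive Borel measure on $[0,\infty)$ with $$f(\omega)=\int_0^\infty\frac{d\sigma_f(\lambda)}{\lambda-(\omega+ih)^2}\qquad(\omega\in\mathbb{H}_h),$$ and we put $\|\sigma_f\|_*=\int_0^\infty\frac{d\sigma_f(\lambda)}{\lambda+1}$. For $\varepsilon>0$ let $$\Delta_h(\varepsilon)=\sup\left\{\frac{|f(\omega_0)-g(\omega_0)|}{\max(\|\sigma_f\|_*,\|\sigma_g\|_*)}\;:\;f,g\in\mathcal{K}_h,\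 \frac{\|f-g\|_{L^2(0,1)}}{\max(\|\sigma_f\|_*,\|\sigma_g\|_*)}\le\varepsilon\right\}.$$ Let $H^2(\mathbb{H}_h)$ be the Hardy space of analytic functions $f$ on $\mathbb{H}_h$ with $\|f\|_{H^2(\mathbb{H}_h)}=\sup_{y>-h}\|f\|_{L^2(\mathbb{R}+iy)}<\infty$, and let $$D_h(\varepsilon)=\sup\left\{|f(\omega_0)|\;:\;f\in H^2(\mathbb{H}_h),\ \overline{f(-\overline{\omega})}=f(\omega)\text{ on }\mathbb{H}_h,\ \|f\|_{H^2(\mathbb{H}_h)}\le1,\ \|f\|_{L^2(-1,1)}\le\varepsilon\right\}.$$ Theorem. For all $0<h'<h$ there is a constant $C>0$, depending only on $h$, $h'$ and the fixed point $\omega_0$ (and not on $\varepsilon$), such that for all sufficiently small $\varepsilon>0$ $$D_h(\varepsilon)\le C\,\Delta_h(\varepsilon)\qquad\text{and}\qquad\Delta_h(\varepsilon)\le C\,D_{h'}(\varepsilon).$$ -/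

import Mathlib

open MeasureTheory Filter Topology Asymptotics Set
open scoped ENNReal NNReal ComplexConjugate

noncomputable section

namespace Permittivity

/-- The open half-plane `{ω : Im ω > -h}`. -/
def halfPlane (h : ℝ) : Set ℂ := {ω : ℂ | -h < ω.im}

/-- The symmetry `Sf = f` on the half-plane, where `(Sf)(ω) = conj (f (-conj ω))`. -/
def IsSymm (h : ℝ) (f : ℂ → ℂ) : Prop :=
  ∀ ω ∈ halfPlane h, conj (f (-conj ω)) = f ω

/-- The class `K_h` of physically admissible functions. Functions on the half-plane are
represented by functions on `ℂ`, whose values off the half-plane play no role. -/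
structure ClassK (h : ℝ) (f : ℂ → ℂ) : Prop where
  /-- Analyticity in the (open) half-plane. -/
  analytic : DifferentiableOn ℂ f (halfPlane h)
  /-- Symmetry. -/
  symm : IsSymm h f
  /-- Passivity. -/
  passive : ∀ ω ∈ halfPlane h, 0 < ω.re → 0 < (f ω).im
  /-- Plasma limit: `f ω = -A ω⁻² + O(ω⁻³)`, `A > 0`, as `ω → ∞` in the half-plane. -/
  plasma : ∃ A : ℝ, 0 < A ∧
    (fun ω : ℂ => f ω - (-(A : ℂ) * (ω ^ 2)⁻¹))
      =O[Bornology.cobounded ℂ ⊓ 𝓟 (halfPlane h)] (fun ω : ℂ => (ω ^ 3)⁻¹)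

/-- `σ` is a spectral measure of `f`: a finite positive Borel measure carried by `[0, ∞)` with
`f ω = ∫ dσ(t) / (t - (ω + i h)²)` for all `ω` in the half-plane. -/
structure IsSpectralMeasure (h : ℝ) (f : ℂ → ℂ) (σ : Measure ℝ) : Prop where
  finite : IsFiniteMeasure σ
  support : σ (Iio 0) = 0
  repr : ∀ ω ∈ halfPlane h,
    f ω = ∫ t : ℝ, ((t : ℂ) - (ω + Complex.I * (h : ℂ)) ^ 2)⁻¹ ∂σ

open Classical in
/-- The spectral measure `σ_f`. Every `f` in `K_h` has exactly one; the value `0` is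
a placeholder for functions that have none. -/
def spectralMeasure (h : ℝ) (f : ℂ → ℂ) : Measure ℝ :=
  if H : ∃ σ : Measure ℝ, IsSpectralMeasure h f σ then H.choose else 0

/-- `‖σ‖ = ∫ dσ(t) / (t + 1)` over `[0, ∞)`. -/
def starNorm (σ : Measure ℝ) : ℝ≥0∞ :=
  ∫⁻ t in Ici (0 : ℝ), ENNReal.ofReal (1 / (t + 1)) ∂σ

/-- `max (‖σ_f‖, ‖σ_g‖)`. -/
def pairNorm (h : ℝ) (f g : ℂ → ℂ) : ℝ≥0∞ :=
  max (starNorm (spectralMeasure h f)) (starNorm (spectralMeasure h g))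

/-- The norm in `L²(a, b)` of the restriction of `f` to the real interval `(a, b)`. -/
def l2Norm (a b : ℝ) (f : ℂ → ℂ) : ℝ≥0∞ :=
  eLpNorm (fun x : ℝ => f (x : ℂ)) 2 (volume.restrict (Ioo a b))

/-- The set `U_h(ε)` of pairs in `K_h` whose relative difference on `(0, 1)` is at most `ε`. -/
def pairs (h ε : ℝ) : Set ((ℂ → ℂ) × (ℂ → ℂ)) :=
  {p | ClassK h p.1 ∧ ClassK h p.2 ∧
    l2Norm 0 1 (p.1 - p.2) / pairNorm h p.1 p.2 ≤ ENNReal.ofReal ε}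

/-- The worst-case relative extrapolation error `Δ_{ω₀,h}(ε)`, as a supremum in `[0, ∞]`. -/
def worstError (ω₀ h ε : ℝ) : ℝ≥0∞ :=
  ⨆ p ∈ pairs h ε, ‖p.1 (ω₀ : ℂ) - p.2 (ω₀ : ℂ)‖ₑ / pairNorm h p.1 p.2

/-- The Hardy norm `sup_{y > -h} ‖f‖_{L²(ℝ + iy)}`, with values in `[0, ∞]`. -/
def hardyNorm (h : ℝ) (f : ℂ → ℂ) : ℝ≥0∞ :=
  ⨆ y ∈ Ioi (-h), eLpNorm (fun x : ℝ => f ((x : ℂ) + Complex.I * (y : ℂ))) 2 volume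

/-- The Hardy class `H²` of the half-plane. -/
def hardySpace (h : ℝ) : Set (ℂ → ℂ) :=
  {f | DifferentiableOn ℂ f (halfPlane h) ∧ hardyNorm h f < ∞}

/-- The functions admissible for `D_h(ε)`. -/
def admissible (h ε : ℝ) : Set (ℂ → ℂ) :=
  {f | f ∈ hardySpace h ∧ IsSymm h f ∧ hardyNorm h f ≤ 1 ∧
    l2Norm (-1) 1 f ≤ ENNReal.ofReal ε}

/-- `D_h(ε)` at the point `ω₀`, as a supremum in `[0, ∞]`. -/
def hardyError (ω₀ h ε : ℝ) : ℝ≥0∞ :=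
  ⨆ f ∈ admissible h ε, ‖f (ω₀ : ℂ)‖ₑ

end Permittivity

end

/-!
Write `ζ = ω + i h`. Both extremal problems are compared by an explicit passage between
differences of transforms `∫ dσ(t) / (t - ζ²)` and functions of the Hardy class.

The norm `‖σ_f‖` is the value of `f` at `ω = i (1 - h)`, where `ζ = i`
(`IsSpectralMeasure.eq_starNorm`), so only the existence of a spectral measure matters. It is
proved as `ClassK.exists_isSpectralMeasure`: Cauchy's formula on the real line (`eq_integral_im`)
represents a symmetric function by its imaginary part on the positive half-line, this is applied
to the shifts `f(· + iδ)`, and the resulting measures, of bounded mass, have a weak limit as `δ →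
0`.

For `Δ_h ≤ C D_{h'}` the difference `f - g` is divided by its norm and by `ζ`. The weighted kernel
`(1 + t) / (ζ (t - ζ²))` is bounded in `L²` of every line `Im ζ ≥ h - h'`, uniformly in `t`, and
by Cauchy–Schwarz the quotient lies in a fixed ball of the Hardy space
(`lintegral_spectralIntegral_sub_sq_le`). Division by `ζ` changes sizes on `(0, 1)` and at `ω₀`
only by constants.

For `D_h ≤ C Δ_h` an admissible `φ` is shifted by `iδ` and multiplied by `(i / (ζ + i))⁶`. Now it
decays and is holomorphic across the line that carries the measures, so that the positive and
negative parts of its imaginary part there are finite densities with finite first moment. Adding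
the same point mass at `0` to both gives `f, g ∈ K_h` with `f - g` equal to the damped shift and
with norms between absolute constants (`exists_classK_sub_eq`). Letting `δ → 0` recovers `φ(ω₀)`.
-/

noncomputable section

namespace Permittivity

/-! ### Contour integrals over the real line -/

/-- A continuous function on a closed set that is `O(‖w‖⁻²)` far away is dominated by a multiple
of `1 / (1 + ‖w‖²)`, since the rest of the set is compact. -/
theorem exists_bound_of_bound_far {S : Set ℂ} (hS : IsClosed S) {G : ℂ → ℂ}
    (hG : ContinuousOn G S) {R C : ℝ}
    (hfar : ∀ w ∈ S, R ≤ ‖w‖ → ‖G w‖ ≤ C / ‖w‖ ^ 2) :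
    ∃ C' : ℝ, ∀ w ∈ S, ‖G w‖ ≤ C' / (1 + ‖w‖ ^ 2) := by
  have hK : IsCompact (S ∩ Metric.closedBall 0 (max R 1)) :=
    (isCompact_closedBall _ _).inter_left hS
  obtain ⟨B, hB⟩ := hK.exists_bound_of_continuousOn (hG.mono inter_subset_left)
  refine ⟨|B| * (1 + (max R 1) ^ 2) + 2 * |C|, fun w hw => ?_⟩
  rw [le_div_iff₀ (by positivity)]
  rcases le_total ‖w‖ (max R 1) with h | h
  · have h1 : ‖G w‖ ≤ |B| := (hB w ⟨hw, by simpa using h⟩).trans (le_abs_self B)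
    have h2 : 1 + ‖w‖ ^ 2 ≤ 1 + (max R 1) ^ 2 := by gcongr
    calc ‖G w‖ * (1 + ‖w‖ ^ 2) ≤ |B| * (1 + (max R 1) ^ 2) := by gcongr
      _ ≤ _ := by linarith [abs_nonneg C]
  · have h1 : 1 ≤ ‖w‖ := (le_max_right _ _).trans h
    have h2 : ‖G w‖ ≤ |C| / ‖w‖ ^ 2 :=
      (hfar w hw ((le_max_left _ _).trans h)).trans (by gcongr; exact le_abs_self C)
    have h3 : 1 ≤ ‖w‖ ^ 2 := one_le_pow₀ h1
    rw [le_div_iff₀ (by positivity)] at h2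
    have h4 : ‖G w‖ * 1 ≤ ‖G w‖ * ‖w‖ ^ 2 := by gcongr
    have : 0 ≤ |B| * (1 + (max R 1) ^ 2) := by positivity
    nlinarith

theorem integrable_of_bound {g : ℝ → ℂ} (hg : Continuous g) {C : ℝ}
    (hb : ∀ x, ‖g x‖ ≤ C / (1 + x ^ 2)) : Integrable g := by
  refine (integrable_inv_one_add_sq.const_mul C).mono' hg.aestronglyMeasurable ?_
  exact ae_of_all _ fun x => by simpa [div_eq_mul_inv] using hb x

/-- A holomorphic function on the closed upper half-plane with quadratic decay has zero integral
over the real line: close the contour with the rectangle `[-R, R] × [0, R]` and let `R → ∞`. -/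
theorem integral_real_eq_zero {G : ℂ → ℂ} {C : ℝ} (hG : DifferentiableOn ℂ G {w | 0 ≤ w.im})
    (hb : ∀ w : ℂ, 0 ≤ w.im → ‖G w‖ ≤ C / (1 + ‖w‖ ^ 2)) : ∫ x : ℝ, G x = 0 := by
  have hC : 0 ≤ C := by
    have := (norm_nonneg _).trans (hb 0 (by simp))
    simpa using this
  have hcont : Continuous fun x : ℝ => G x :=
    hG.continuousOn.comp_continuous Complex.continuous_ofReal (fun x => by simp)
  have hint : Integrable fun x : ℝ => G x :=
    integrable_of_bound hcont (fun x => by simpa using hb x (by simp))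
  have hlim := intervalIntegral_tendsto_integral hint tendsto_neg_atTop_atBot tendsto_id
  have hzero : Tendsto (fun R : ℝ => ∫ x in (-R)..R, G x) atTop (𝓝 0) := by
    have hlim0 : Tendsto (fun R : ℝ => 4 * C / R) atTop (𝓝 0) :=
      tendsto_const_nhds.div_atTop tendsto_id
    refine squeeze_zero_norm' ?_ hlim0
    filter_upwards [eventually_gt_atTop 0] with R hR
    have hrect := Complex.integral_boundary_rect_eq_zero_of_differentiableOn G
      (-R : ℂ) (R + R * Complex.I) (hG.mono fun w hw => by
        have := hw.2
        simp only [mem_preimage] at this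
        simp [uIcc_of_le hR.le] at this
        exact this.1)
    simp only [Complex.neg_re, Complex.ofReal_re, Complex.neg_im, Complex.ofReal_im, neg_zero,
      Complex.add_re, Complex.mul_re, Complex.I_re, mul_zero, Complex.I_im, mul_one, sub_self,
      add_zero, Complex.add_im, Complex.mul_im, zero_add, Complex.ofReal_zero, zero_mul] at hrect
    have hbd : ∀ w : ℂ, 0 ≤ w.im → R ≤ ‖w‖ → ‖G w‖ ≤ C / R ^ 2 := fun w hw hRw =>
      (hb w hw).trans (by gcongr; nlinarith)
    have h1 : ‖∫ x in (-R)..R, G (x + R * Complex.I)‖ ≤ C / R ^ 2 * |R - -R| := by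
      refine intervalIntegral.norm_integral_le_of_norm_le_const fun x _ =>
        hbd _ (by simpa using hR.le) ?_
      refine le_trans ?_ (Complex.abs_im_le_norm _)
      simp [le_abs_self]
    have h2 : ‖∫ y in (0 : ℝ)..R, G (R + y * Complex.I)‖ ≤ C / R ^ 2 * |R - 0| := by
      refine intervalIntegral.norm_integral_le_of_norm_le_const fun x hx => hbd _ ?_ ?_
      · rw [uIoc_of_le hR.le] at hx; simpa using hx.1.le
      · refine le_trans ?_ (Complex.abs_re_le_norm _)
        simp [le_abs_self]
    have h3 : ‖∫ y in (0 : ℝ)..R, G (-R + y * Complex.I)‖ ≤ C / R ^ 2 * |R - 0| := by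
      refine intervalIntegral.norm_integral_le_of_norm_le_const fun x hx => hbd _ ?_ ?_
      · rw [uIoc_of_le hR.le] at hx; simpa using hx.1.le
      · refine le_trans ?_ (Complex.abs_re_le_norm _)
        simp [le_abs_self]
    have e : (∫ x in (-R)..R, G x) = (∫ x in (-R)..R, G (x + R * Complex.I))
        - Complex.I • (∫ y in (0 : ℝ)..R, G (R + y * Complex.I))
        + Complex.I • (∫ y in (0 : ℝ)..R, G (-R + y * Complex.I)) := by
      push_cast at hrect
      linear_combination hrect
    rw [e]
    refine (norm_add_le _ _).trans ((add_le_add (norm_sub_le _ _) le_rfl).trans ?_)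
    rw [norm_smul, norm_smul, Complex.norm_I, one_mul, one_mul]
    rw [abs_of_pos (by linarith)] at h1 h2 h3
    refine (add_le_add (add_le_add h1 h2) h3).trans (le_of_eq ?_)
    field_simp
    ring
  exact tendsto_nhds_unique hlim hzero

/-- The integrand is `1 / (x - ζ) - 1 / (x - conj ζ)`, which is `2πi` times the Poisson kernel of
the upper half-plane. -/
theorem integral_poisson {ζ : ℂ} (hζ : 0 < ζ.im) :
    ∫ x : ℝ, ((ζ - conj ζ) / (((x : ℂ) - conj ζ) * (x - ζ))) = 2 * Real.pi * Complex.I := by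
  have e : ∀ x : ℝ, ((ζ - conj ζ) / (((x : ℂ) - conj ζ) * (x - ζ)))
      = ((2 / ζ.im * (1 + ((x - ζ.re) / ζ.im) ^ 2)⁻¹ : ℝ) : ℂ) * Complex.I := by
    intro x
    have h1 : ((x : ℂ) - conj ζ) * (x - ζ) = (((x - ζ.re) ^ 2 + ζ.im ^ 2 : ℝ) : ℂ) := by
      apply Complex.ext <;> simp [pow_two]; ring
    have h2 : ζ - conj ζ = ((2 * ζ.im : ℝ) : ℂ) * Complex.I := by
      apply Complex.ext <;> simp; ring
    have h3 : (2 / ζ.im * (1 + ((x - ζ.re) / ζ.im) ^ 2)⁻¹ : ℝ)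
        = 2 * ζ.im / ((x - ζ.re) ^ 2 + ζ.im ^ 2) := by
      field_simp; ring
    rw [h1, h2, h3]
    push_cast
    ring
  simp_rw [e]
  rw [integral_mul_const, integral_complex_ofReal, integral_const_mul]
  have : ∫ x : ℝ, (1 + ((x - ζ.re) / ζ.im) ^ 2)⁻¹ = ζ.im * Real.pi := by
    rw [integral_sub_right_eq_self (fun x : ℝ => (1 + (x / ζ.im) ^ 2)⁻¹) ζ.re,
      Measure.integral_comp_div (fun x : ℝ => (1 + x ^ 2)⁻¹) ζ.im,
      integral_univ_inv_one_add_sq, abs_of_pos hζ, smul_eq_mul]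
  rw [this]
  have : (2 / ζ.im * (ζ.im * Real.pi) : ℝ) = 2 * Real.pi := by field_simp
  rw [this]
  push_cast
  ring

/-! ### Functions on the upper half-plane from their boundary imaginary part -/

/-- Cauchy's formula on the real line for the kernel `2w / (w² - ζ²)`. Its pole at `ζ` is
cancelled by a multiple of the Poisson kernel, whose integral is known, so that no winding number
of a contour is needed. -/
theorem integral_kernel_eq {ψ : ℂ → ℂ} {C : ℝ} (hψ : DifferentiableOn ℂ ψ {w | 0 ≤ w.im})
    (hb : ∀ w : ℂ, 0 ≤ w.im → ‖ψ w‖ ≤ C / (1 + ‖w‖ ^ 2)) {ζ : ℂ} (hζ : 0 < ζ.im) :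
    Integrable (fun x : ℝ => ψ x * (2 * x) * ((x : ℂ) ^ 2 - ζ ^ 2)⁻¹) ∧
    ∫ x : ℝ, ψ x * (2 * x) * ((x : ℂ) ^ 2 - ζ ^ 2)⁻¹ = 2 * Real.pi * Complex.I * ψ ζ := by
  have hC : 0 ≤ C := by
    have := (norm_nonneg _).trans (hb 0 (by simp))
    simpa using this
  set S : Set ℂ := {w | 0 ≤ w.im} with hS
  have hSc : IsClosed S := isClosed_le continuous_const Complex.continuous_im
  have hSn : S ∈ 𝓝 ζ := mem_of_superset
    ((isOpen_lt continuous_const Complex.continuous_im).mem_nhds hζ) fun w (hw : 0 < w.im) => hw.le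
  have hne1 : ∀ w ∈ S, w + ζ ≠ 0 := fun w hw h => by
    have := congrArg Complex.im h
    simp only [Complex.add_im, Complex.zero_im] at this
    have hw' : 0 ≤ w.im := hw
    linarith
  have hne2 : ∀ w ∈ S, w - conj ζ ≠ 0 := fun w hw h => by
    have := congrArg Complex.im h
    simp at this
    have hw' : 0 ≤ w.im := hw
    linarith
  -- The difference of the two kernels is `dslope q ζ`, with the singularity at `ζ` removed.
  let q : ℂ → ℂ := fun w => ψ w * (2 * w) / (w + ζ) - ψ ζ * (ζ - conj ζ) / (w - conj ζ)
  have hq : DifferentiableOn ℂ q S := by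
    refine DifferentiableOn.sub ?_ ?_
    · exact (hψ.mul (by fun_prop)).div (by fun_prop) hne1
    · exact DifferentiableOn.div (by fun_prop) (by fun_prop) hne2
  have hqζ : q ζ = 0 := by
    have h1 := hne1 ζ hζ.le
    have h2 := hne2 ζ hζ.le
    have : ζ ≠ 0 := by rintro rfl; simp at hζ
    simp only [q]
    field_simp
    ring
  have hG : DifferentiableOn ℂ (dslope q ζ) S := (Complex.differentiableOn_dslope hSn).2 hq
  have hGeq : ∀ w, w ≠ ζ → dslope q ζ w = q w / (w - ζ) := fun w hw => by
    rw [dslope_of_ne _ hw, slope_def_field, hqζ, sub_zero]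
  obtain ⟨C', hC'⟩ := exists_bound_of_bound_far hSc hG.continuousOn
    (R := 2 * ‖ζ‖ + 1) (C := 2 * (4 * C + 2 * (‖ψ ζ‖ * ‖ζ - conj ζ‖))) (by
      intro w hw hR
      have hz := norm_nonneg ζ
      have hw1 : 1 ≤ ‖w‖ := by linarith
      have hw0 : 0 < ‖w‖ := by linarith
      have hwz : w ≠ ζ := by rintro rfl; linarith
      have a1 : ‖w‖ / 2 ≤ ‖w + ζ‖ := by
        have := norm_sub_norm_le w (-ζ)
        rw [norm_neg, sub_neg_eq_add] at this
        linarith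
      have a2 : ‖w‖ / 2 ≤ ‖w - ζ‖ := by linarith [norm_sub_norm_le w ζ]
      have a3 : ‖w‖ / 2 ≤ ‖w - conj ζ‖ := by
        have := norm_sub_norm_le w (conj ζ)
        rw [Complex.norm_conj] at this
        linarith
      have hψw : ‖ψ w‖ ≤ C / ‖w‖ := (hb w hw).trans (by gcongr; nlinarith)
      have hqw : ‖q w‖ ≤ (4 * C + 2 * (‖ψ ζ‖ * ‖ζ - conj ζ‖)) / ‖w‖ := by
        refine (norm_sub_le _ _).trans ?_
        rw [norm_div, norm_mul, norm_mul, norm_div, norm_mul, Complex.norm_ofNat]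
        have b1 : ‖ψ w‖ * (2 * ‖w‖) / ‖w + ζ‖ ≤ C / ‖w‖ * (2 * ‖w‖) / (‖w‖ / 2) := by gcongr
        have b2 : ‖ψ ζ‖ * ‖ζ - conj ζ‖ / ‖w - conj ζ‖ ≤ ‖ψ ζ‖ * ‖ζ - conj ζ‖ / (‖w‖ / 2) := by
          gcongr
        refine (add_le_add b1 b2).trans (le_of_eq ?_)
        field_simp
        ring
      rw [hGeq w hwz, norm_div]
      calc ‖q w‖ / ‖w - ζ‖ ≤ (4 * C + 2 * (‖ψ ζ‖ * ‖ζ - conj ζ‖)) / ‖w‖ / (‖w‖ / 2) := by gcongr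
        _ = _ := by field_simp)
  have h0 := integral_real_eq_zero hG hC'
  have hxne : ∀ x : ℝ, (x : ℂ) ≠ ζ := fun x h => by
    rw [← h] at hζ; simp at hζ
  have hxS : ∀ x : ℝ, (x : ℂ) ∈ S := fun x => by simp [hS]
  have hGx : ∀ x : ℝ, dslope q ζ x = ψ x * (2 * x) * ((x : ℂ) ^ 2 - ζ ^ 2)⁻¹
      - ψ ζ * ((ζ - conj ζ) / (((x : ℂ) - conj ζ) * (x - ζ))) := fun x => by
    have h1 := hne1 x (hxS x)
    have h2 := hne2 x (hxS x)
    have h3 := sub_ne_zero.2 (hxne x)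
    have h4 : (x : ℂ) ^ 2 - ζ ^ 2 = (x + ζ) * (x - ζ) := by ring
    rw [hGeq _ (hxne x), h4]
    simp only [q]
    field_simp
  have hGint : Integrable fun x : ℝ => dslope q ζ x :=
    integrable_of_bound (hG.continuousOn.comp_continuous Complex.continuous_ofReal hxS)
      (fun x => by simpa using hC' x (hxS x))
  have hPint : Integrable fun x : ℝ => (ζ - conj ζ) / (((x : ℂ) - conj ζ) * (x - ζ)) := by
    by_contra h
    have := integral_undef h
    rw [integral_poisson hζ] at this
    simp [Real.pi_ne_zero] at this
  have hint : Integrable (fun x : ℝ => ψ x * (2 * x) * ((x : ℂ) ^ 2 - ζ ^ 2)⁻¹) := by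
    refine (hGint.add (hPint.const_mul (ψ ζ))).congr (ae_of_all _ fun x => ?_)
    simp only [Pi.add_apply, hGx]
    ring
  refine ⟨hint, ?_⟩
  simp_rw [hGx] at h0
  rw [integral_sub hint (hPint.const_mul _), integral_const_mul, integral_poisson hζ,
    sub_eq_zero] at h0
  rw [h0]
  ring

/-- A symmetric function is recovered from its imaginary part on the half-line: in
`integral_kernel_eq` the kernel is odd and `ψ(-x) = conj (ψ x)`, so folding leaves `2i Im ψ`. -/
theorem eq_integral_im {ψ : ℂ → ℂ} {C : ℝ} (hψ : DifferentiableOn ℂ ψ {w | 0 ≤ w.im})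
    (hb : ∀ w : ℂ, 0 ≤ w.im → ‖ψ w‖ ≤ C / (1 + ‖w‖ ^ 2))
    (hsymm : ∀ x : ℝ, ψ (-x) = conj (ψ x)) {ζ : ℂ} (hζ : 0 < ζ.im) :
    IntegrableOn (fun x : ℝ => ((2 / Real.pi * (x * (ψ x).im) : ℝ) : ℂ) *
      (((x ^ 2 : ℝ) : ℂ) - ζ ^ 2)⁻¹) (Ioi 0) ∧
    ψ ζ = ∫ x in Ioi (0 : ℝ),
      ((2 / Real.pi * (x * (ψ x).im) : ℝ) : ℂ) * (((x ^ 2 : ℝ) : ℂ) - ζ ^ 2)⁻¹ := by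
  obtain ⟨hint, h⟩ := integral_kernel_eq hψ hb hζ
  have hneg := integral_comp_neg_Ioi 0 (fun x : ℝ => ψ x * (2 * x) * ((x : ℂ) ^ 2 - ζ ^ 2)⁻¹)
  rw [neg_zero] at hneg
  have hsplit := intervalIntegral.integral_Iic_add_Ioi (b := (0 : ℝ)) hint.integrableOn
    hint.integrableOn
  have hint' : IntegrableOn (fun x : ℝ => ψ (-x : ℝ) * (2 * (-x : ℝ)) *
      (((-x : ℝ) : ℂ) ^ 2 - ζ ^ 2)⁻¹) (Ioi 0) := hint.comp_neg.integrableOn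
  have hpi : (2 * Real.pi * Complex.I : ℂ) ≠ 0 := by
    simp [Real.pi_ne_zero]
  have hfold : ∀ x : ℝ, ψ (-x : ℝ) * (2 * (-x : ℝ)) * (((-x : ℝ) : ℂ) ^ 2 - ζ ^ 2)⁻¹
      + ψ x * (2 * x) * ((x : ℂ) ^ 2 - ζ ^ 2)⁻¹ = 2 * Real.pi * Complex.I *
      (((2 / Real.pi * (x * (ψ x).im) : ℝ) : ℂ) * (((x ^ 2 : ℝ) : ℂ) - ζ ^ 2)⁻¹) := fun x => by
    have e : ψ x - conj (ψ x) = 2 * Complex.I * ((ψ x).im : ℂ) := by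
      rw [Complex.sub_conj]; push_cast; ring
    have : (Real.pi : ℂ) ≠ 0 := by simp [Real.pi_ne_zero]
    push_cast
    rw [hsymm, neg_sq]
    have : 2 * (Real.pi : ℂ) * Complex.I *
        (2 / Real.pi * (x * (ψ x).im) * ((x : ℂ) ^ 2 - ζ ^ 2)⁻¹)
        = 2 * Complex.I * ((ψ x).im : ℂ) * (2 * x) * ((x : ℂ) ^ 2 - ζ ^ 2)⁻¹ := by
      field_simp
    rw [this, ← e]
    ring
  have hadd := hint'.add hint.integrableOn
  refine ⟨?_, ?_⟩
  · refine (hadd.const_mul (2 * Real.pi * Complex.I : ℂ)⁻¹).congr (ae_of_all _ fun x => ?_)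
    simp only [Pi.add_apply]
    rw [hfold, inv_mul_cancel_left₀ hpi]
  · rw [← hneg, ← integral_add hint' hint.integrableOn, h] at hsplit
    refine mul_left_cancel₀ hpi ?_
    rw [← hsplit, ← integral_const_mul]
    exact integral_congr_ae (ae_of_all _ hfold)

/-! ### The transform of a measure on `[0, ∞)` and the class `K_h` -/

/-- The transform `∫ dσ(t) / (t - ζ²)`. A function with spectral measure `σ` is `ω ↦
spectralIntegral σ (ω + i h)`; here `ζ = ω + i h` ranges over the upper half-plane. -/
def spectralIntegral (σ : Measure ℝ) (ζ : ℂ) : ℂ := ∫ t : ℝ, ((t : ℂ) - ζ ^ 2)⁻¹ ∂σ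

theorem ae_nonneg_of_support {σ : Measure ℝ} (hs : σ (Iio 0) = 0) : ∀ᵐ t ∂σ, 0 ≤ t := by
  rw [ae_iff]
  convert hs using 2
  ext t; simp

/-- With `t = s²` one has `t - ζ² = (s - ζ)(s + ζ)`; both factors are at least `Im ζ`, and the one
whose real part does not cancel is at least `‖ζ‖`. -/
theorem mul_norm_le_norm_sub_sq {t : ℝ} (ht : 0 ≤ t) {ζ : ℂ} (hζ : 0 ≤ ζ.im) :
    ζ.im * ‖ζ‖ ≤ ‖(t : ℂ) - ζ ^ 2‖ := by
  obtain ⟨s, hs, rfl⟩ : ∃ s : ℝ, 0 ≤ s ∧ s ^ 2 = t := ⟨√t, Real.sqrt_nonneg t, Real.sq_sqrt ht⟩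
  have e : (((s ^ 2 : ℝ) : ℂ)) - ζ ^ 2 = (s - ζ) * (s + ζ) := by push_cast; ring
  rw [e, norm_mul]
  have h1 : ζ.im ≤ ‖(s : ℂ) - ζ‖ := by
    refine le_trans ?_ (Complex.abs_im_le_norm _)
    simp [abs_of_nonneg hζ]
  have h2 : ζ.im ≤ ‖(s : ℂ) + ζ‖ := by
    refine le_trans ?_ (Complex.abs_im_le_norm _)
    simp [abs_of_nonneg hζ]
  rcases le_total 0 ζ.re with h | h
  · have h3 : ‖ζ‖ ≤ ‖(s : ℂ) + ζ‖ := by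
      rw [← sq_le_sq₀ (norm_nonneg _) (norm_nonneg _), Complex.sq_norm, Complex.sq_norm,
        Complex.normSq_apply, Complex.normSq_apply]
      simp
      nlinarith
    gcongr
  · have h3 : ‖ζ‖ ≤ ‖(s : ℂ) - ζ‖ := by
      rw [← sq_le_sq₀ (norm_nonneg _) (norm_nonneg _), Complex.sq_norm, Complex.sq_norm,
        Complex.normSq_apply, Complex.normSq_apply]
      simp
      nlinarith
    rw [mul_comm]
    gcongr

theorem sq_le_norm_sub_sq {t : ℝ} (ht : 0 ≤ t) {ζ : ℂ} (hζ : 0 ≤ ζ.im) :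
    ζ.im ^ 2 ≤ ‖(t : ℂ) - ζ ^ 2‖ := by
  refine le_trans ?_ (mul_norm_le_norm_sub_sq ht hζ)
  rw [sq]
  gcongr
  exact (le_abs_self _).trans (Complex.abs_im_le_norm ζ)

theorem sub_sq_ne_zero {t : ℝ} (ht : 0 ≤ t) {ζ : ℂ} (hζ : 0 < ζ.im) : (t : ℂ) - ζ ^ 2 ≠ 0 :=
  norm_pos_iff.1 ((by positivity : 0 < ζ.im ^ 2).trans_le (sq_le_norm_sub_sq ht hζ.le))

theorem norm_kernel_le {t : ℝ} (ht : 0 ≤ t) {ζ : ℂ} (hζ : 0 < ζ.im) :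
    ‖((t : ℂ) - ζ ^ 2)⁻¹‖ ≤ (ζ.im ^ 2)⁻¹ := by
  rw [norm_inv]
  exact inv_anti₀ (by positivity) (sq_le_norm_sub_sq ht hζ.le)

theorem measurable_kernel (ζ : ℂ) : Measurable fun t : ℝ => ((t : ℂ) - ζ ^ 2)⁻¹ := by fun_prop

theorem integrable_kernel {σ : Measure ℝ} [IsFiniteMeasure σ] (hs : σ (Iio 0) = 0) {ζ : ℂ}
    (hζ : 0 < ζ.im) : Integrable (fun t : ℝ => ((t : ℂ) - ζ ^ 2)⁻¹) σ :=
  Integrable.of_bound (measurable_kernel ζ).aestronglyMeasurable (ζ.im ^ 2)⁻¹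
    ((ae_nonneg_of_support hs).mono fun _ ht => norm_kernel_le ht hζ)

theorem differentiableAt_spectralIntegral {σ : Measure ℝ} [IsFiniteMeasure σ]
    (hs : σ (Iio 0) = 0) {ζ : ℂ} (hζ : 0 < ζ.im) : DifferentiableAt ℂ (spectralIntegral σ) ζ := by
  have hball : ∀ w ∈ Metric.ball ζ (ζ.im / 2), ζ.im / 2 < w.im := fun w hw => by
    rw [mem_ball_iff_norm] at hw
    have := (Complex.abs_im_le_norm (w - ζ)).trans_lt hw
    rw [Complex.sub_im, abs_lt] at this
    linarith
  refine (hasDerivAt_integral_of_dominated_loc_of_deriv_le (μ := σ) (x₀ := ζ)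
    (F := fun w t => ((t : ℂ) - w ^ 2)⁻¹) (F' := fun w t => (2 * w) / ((t : ℂ) - w ^ 2) ^ 2)
    (bound := fun _ => 2 / (ζ.im / 2) ^ 3)
    (Metric.ball_mem_nhds ζ (by positivity : 0 < ζ.im / 2)) ?_
    (integrable_kernel hs hζ) ?_ ?_ ?_ ?_).2.differentiableAt
  · exact .of_forall fun w => (measurable_kernel w).aestronglyMeasurable
  · exact Measurable.aestronglyMeasurable (by fun_prop)
  · filter_upwards [ae_nonneg_of_support hs] with t ht w hw
    have hw' := hball w hw
    have hw0 : 0 < w.im := by linarith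
    have h1 := mul_norm_le_norm_sub_sq ht hw0.le
    have h2 : ζ.im / 2 ≤ ‖w‖ := hw'.le.trans ((le_abs_self _).trans (Complex.abs_im_le_norm w))
    have hw1 : 0 < ‖w‖ := by linarith
    rw [norm_div, norm_mul, norm_pow, Complex.norm_ofNat]
    calc 2 * ‖w‖ / ‖(t : ℂ) - w ^ 2‖ ^ 2 ≤ 2 * ‖w‖ / (w.im * ‖w‖) ^ 2 := by gcongr
      _ = 2 / (w.im ^ 2 * ‖w‖) := by field_simp
      _ ≤ 2 / ((ζ.im / 2) ^ 2 * (ζ.im / 2)) := by gcongr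
      _ = _ := by ring
  · exact integrable_const _
  · filter_upwards [ae_nonneg_of_support hs] with t ht w hw
    have hne := sub_sq_ne_zero ht (show 0 < w.im by linarith [hball w hw])
    have h1 : HasDerivAt (fun w : ℂ => (t : ℂ) - w ^ 2) (-(2 * w)) w := by
      simpa using ((hasDerivAt_id w).pow 2).const_sub (t : ℂ)
    have h2 := h1.fun_inv hne
    rwa [neg_neg] at h2

theorem conj_spectralIntegral (σ : Measure ℝ) (ζ : ℂ) :
    conj (spectralIntegral σ (-conj ζ)) = spectralIntegral σ ζ := by
  rw [spectralIntegral, ← integral_conj]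
  simp [spectralIntegral]

theorem im_kernel (t : ℝ) (ζ : ℂ) :
    (((t : ℂ) - ζ ^ 2)⁻¹).im = 2 * ζ.re * ζ.im / Complex.normSq ((t : ℂ) - ζ ^ 2) := by
  rw [Complex.inv_im]
  simp [pow_two]
  ring

theorem im_spectralIntegral_pos {σ : Measure ℝ} [IsFiniteMeasure σ]
    (hs : σ (Iio 0) = 0) (hne : σ ≠ 0)
    {ζ : ℂ} (hζ : 0 < ζ.im) (hre : 0 < ζ.re) : 0 < (spectralIntegral σ ζ).im := by
  have hint := integrable_kernel hs hζ
  have e : (spectralIntegral σ ζ).im = ∫ t : ℝ, (((t : ℂ) - ζ ^ 2)⁻¹).im ∂σ :=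
    (integral_im hint).symm
  have hpos : ∀ᵐ t : ℝ ∂σ, 0 < (((t : ℂ) - ζ ^ 2)⁻¹).im := by
    filter_upwards [ae_nonneg_of_support hs] with t ht
    rw [im_kernel]
    have := Complex.normSq_pos.2 (sub_sq_ne_zero ht hζ)
    positivity
  rw [e, integral_pos_iff_support_of_nonneg_ae (hpos.mono fun t ht => ht.le) hint.im]
  rw [pos_iff_ne_zero]
  intro h0
  have : ∀ᵐ t : ℝ ∂σ, t ∉ Function.support fun t : ℝ => (((t : ℂ) - ζ ^ 2)⁻¹).im :=
    measure_eq_zero_iff_ae_notMem.1 h0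
  have hF : ∀ᵐ _ : ℝ ∂σ, False := by
    filter_upwards [this, hpos] with t h1 h2
    exact h1 h2.ne'
  exact hne (ae_eq_bot.1 (Filter.eventually_false_iff_eq_bot.1 hF))

theorem spectralIntegral_I (σ : Measure ℝ) :
    spectralIntegral σ Complex.I = ((∫ t, (t + 1)⁻¹ ∂σ : ℝ) : ℂ) := by
  rw [spectralIntegral, ← integral_complex_ofReal]
  simp

/-- The plasma limit of a measure with finite first moment. The bound degenerates on the real
axis, so it is used on half-planes `Im ζ ≥ η > 0` only. -/
theorem norm_spectralIntegral_add_le {σ : Measure ℝ} [IsFiniteMeasure σ] (hs : σ (Iio 0) = 0)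
    (hmom : Integrable (fun t : ℝ => t) σ) {ζ : ℂ} (hζ : 0 < ζ.im) :
    ‖spectralIntegral σ ζ + (σ.real univ : ℂ) * (ζ ^ 2)⁻¹‖ ≤ (∫ t, t ∂σ) / (ζ.im * ‖ζ‖ ^ 3) := by
  have hζ0 : ζ ≠ 0 := by rintro rfl; simp at hζ
  have hn : 0 < ‖ζ‖ := norm_pos_iff.2 hζ0
  have hint := integrable_kernel hs hζ
  have e : spectralIntegral σ ζ + (σ.real univ : ℂ) * (ζ ^ 2)⁻¹
      = ∫ t : ℝ, (((t : ℂ) - ζ ^ 2)⁻¹ + (ζ ^ 2)⁻¹) ∂σ := by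
    rw [integral_add hint (integrable_const _), spectralIntegral]
    simp
  rw [e, ← integral_div]
  refine norm_integral_le_of_norm_le (hmom.div_const _) ?_
  filter_upwards [ae_nonneg_of_support hs] with t ht
  have hne := sub_sq_ne_zero ht hζ
  have : ((t : ℂ) - ζ ^ 2)⁻¹ + (ζ ^ 2)⁻¹ = t / (((t : ℂ) - ζ ^ 2) * ζ ^ 2) := by
    field_simp; ring
  rw [this, norm_div, norm_mul, norm_pow, Complex.norm_real, Real.norm_of_nonneg ht]
  have hle : ζ.im * ‖ζ‖ ^ 3 ≤ ‖(t : ℂ) - ζ ^ 2‖ * ‖ζ‖ ^ 2 := by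
    calc ζ.im * ‖ζ‖ ^ 3 = ζ.im * ‖ζ‖ * ‖ζ‖ ^ 2 := by ring
      _ ≤ _ := by gcongr; exact mul_norm_le_norm_sub_sq ht hζ.le
  exact div_le_div_of_nonneg_left ht (by positivity) hle

/-- Measures with finite first moment produce members of `K_h` when the transform is anchored on a
strictly lower line `Im ω = -H`: the half-plane of `K_h` then stays away from the support. -/
theorem classK_spectralIntegral {σ : Measure ℝ} [IsFiniteMeasure σ]
    (hs : σ (Iio 0) = 0) (hne : σ ≠ 0)
    (hmom : Integrable (fun t : ℝ => t) σ) {h H : ℝ} (hh : 0 < h) (hH : h < H) :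
    ClassK h (fun ω => spectralIntegral σ (ω + Complex.I * H)) := by
  have him : ∀ ω ∈ halfPlane h, H - h < (ω + Complex.I * H).im := fun ω hω => by
    have : -h < ω.im := hω
    simp; linarith
  have hpos : ∀ ω ∈ halfPlane h, 0 < (ω + Complex.I * H).im := fun ω hω => by
    linarith [him ω hω]
  refine ⟨fun ω hω => ?_, fun ω hω => ?_, fun ω hω hre => ?_, ?_⟩
  · refine DifferentiableAt.differentiableWithinAt ?_
    exact DifferentiableAt.comp (g := spectralIntegral σ) ω
      (differentiableAt_spectralIntegral hs (hpos ω hω))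
      (by fun_prop)
  · have : -conj ω + Complex.I * H = -conj (ω + Complex.I * H) := by
      simp [add_comm]
    rw [this, conj_spectralIntegral]
  · exact im_spectralIntegral_pos hs hne (hpos ω hω) (by simpa using hre)
  · have hA : 0 < σ.real univ := by
      rw [measureReal_def, ENNReal.toReal_pos_iff]
      exact ⟨pos_iff_ne_zero.2 (by simpa using hne), measure_lt_top _ _⟩
    refine ⟨σ.real univ, hA, ?_⟩
    have hm : 0 ≤ ∫ t, t ∂σ := integral_nonneg_of_ae (ae_nonneg_of_support hs)
    refine IsBigO.of_bound (8 * (∫ t, t ∂σ) / (H - h) + 12 * σ.real univ * H) ?_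
    rw [eventually_inf_principal]
    filter_upwards [eventually_cobounded_le_norm (2 * H)] with ω hω hmem
    have hH0 : 0 < H := hh.trans hH
    have hω0 : 0 < ‖ω‖ := by linarith
    have hωne : ω ≠ 0 := norm_pos_iff.1 hω0
    set ζ := ω + Complex.I * H with hζdef
    have hnH : ‖Complex.I * (H : ℂ)‖ = H := by
      simp [abs_of_pos hH0]
    have hζω : ‖ω‖ / 2 ≤ ‖ζ‖ := by
      have := norm_sub_le_norm_add ω (Complex.I * H)
      rw [hnH] at this
      linarith
    have hζ0 : 0 < ‖ζ‖ := by linarith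
    have hζne : ζ ≠ 0 := norm_pos_iff.1 hζ0
    have h1 := norm_spectralIntegral_add_le hs hmom (hpos ω hmem)
    have h2 : (∫ t, t ∂σ) / (ζ.im * ‖ζ‖ ^ 3) ≤ (∫ t, t ∂σ) / ((H - h) * (‖ω‖ / 2) ^ 3) := by
      have := (him ω hmem).le
      have h0 : 0 < H - h := by linarith
      have h4 : 0 ≤ ζ.im := h0.le.trans this
      gcongr
    -- Passing from `ζ⁻²` to `ω⁻²` costs `O(ω⁻³)`, as `ζ - ω` is constant.
    have e : (σ.real univ : ℂ) * (ω ^ 2)⁻¹ - (σ.real univ : ℂ) * (ζ ^ 2)⁻¹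
        = (σ.real univ : ℂ) * (Complex.I * H) * (ω + ζ) / (ω ^ 2 * ζ ^ 2) := by
      have : Complex.I * H = ζ - ω := by rw [hζdef]; ring
      rw [this]
      field_simp
      ring
    have h3 : ‖(σ.real univ : ℂ) * (ω ^ 2)⁻¹ - (σ.real univ : ℂ) * (ζ ^ 2)⁻¹‖
        ≤ 12 * σ.real univ * H / ‖ω‖ ^ 3 := by
      have hsum : ‖ω + ζ‖ ≤ 3 * ‖ω‖ := by
        have e1 : ω + ζ = ω + ω + Complex.I * H := by rw [hζdef]; ring
        have := norm_add₃_le (a := ω) (b := ω) (c := Complex.I * H)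
        rw [e1]
        linarith
      rw [e, norm_div, norm_mul, norm_mul (σ.real univ : ℂ), norm_mul (ω ^ 2), norm_pow, norm_pow,
        hnH, Complex.norm_real,
        Real.norm_of_nonneg hA.le]
      calc σ.real univ * H * ‖ω + ζ‖ / (‖ω‖ ^ 2 * ‖ζ‖ ^ 2)
          ≤ σ.real univ * H * (3 * ‖ω‖) / (‖ω‖ ^ 2 * (‖ω‖ / 2) ^ 2) := by gcongr
        _ = _ := by field_simp; ring
    have e2 : spectralIntegral σ ζ - -(σ.real univ : ℂ) * (ω ^ 2)⁻¹ =
        (spectralIntegral σ ζ + (σ.real univ : ℂ) * (ζ ^ 2)⁻¹) +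
        ((σ.real univ : ℂ) * (ω ^ 2)⁻¹ - (σ.real univ : ℂ) * (ζ ^ 2)⁻¹) := by ring
    rw [e2]
    refine (norm_add_le _ _).trans ((add_le_add (h1.trans h2) h3).trans (le_of_eq ?_))
    rw [norm_inv, norm_pow]
    have : H - h ≠ 0 := by linarith
    field_simp
    ring

/-! ### Weak limits, and measures with a density in `x = √t` -/

/-- The chart `t ↦ 1 / (1 + t)` of `[0, ∞)` into the compact interval `[0, 1]`; the absolute value
extends it to `ℝ`. -/
def compactChart (t : ℝ) : Icc (0 : ℝ) 1 :=
  ⟨(1 + |t|)⁻¹, by positivity, inv_le_one_of_one_le₀ (by linarith [abs_nonneg t])⟩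

theorem continuous_compactChart : Continuous compactChart := by
  refine Continuous.subtype_mk (Continuous.inv₀ (by fun_prop) fun t => ?_) _
  positivity

/-- The kernel `1 / (t - ζ²)` in the coordinate `s = 1 / (1 + t)`. -/
def chartKernel (ζ : ℂ) (s : Icc (0 : ℝ) 1) : ℂ := (s : ℂ) / (1 - s - s * ζ ^ 2)

theorem continuous_chartKernel {ζ : ℂ} (hζ : 0 < ζ.im) : Continuous (chartKernel ζ) := by
  refine Continuous.div (by fun_prop) (by fun_prop) fun s h => ?_
  rcases s.2.1.eq_or_lt with h0 | h0
  · rw [← h0] at h; simp at h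
  · have hs : ((s : ℝ) : ℂ) ≠ 0 := by exact_mod_cast h0.ne'
    refine sub_sq_ne_zero (t := (s : ℝ)⁻¹ - 1) ?_ hζ ?_
    · rw [sub_nonneg]; exact (one_le_inv₀ h0).2 s.2.2
    · push_cast
      field_simp
      linear_combination h

theorem chartKernel_eq {ζ : ℂ} {s : Icc (0 : ℝ) 1} (hs : (s : ℝ) ≠ 0) :
    chartKernel ζ s = ((((s : ℝ)⁻¹ - 1 : ℝ) : ℂ) - ζ ^ 2)⁻¹ := by
  have hs' : ((s : ℝ) : ℂ) ≠ 0 := by exact_mod_cast hs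
  rw [chartKernel, ← inv_div]
  congr 1
  push_cast
  field_simp

theorem chartKernel_compactChart {ζ : ℂ} {t : ℝ} (ht : 0 ≤ t) :
    chartKernel ζ (compactChart t) = ((t : ℂ) - ζ ^ 2)⁻¹ := by
  have : ((compactChart t : ℝ)) = (1 + t)⁻¹ := by simp [compactChart, abs_of_nonneg ht]
  rw [chartKernel_eq (by rw [this]; positivity), this]
  simp

/-- Helly selection for the transform: limits of transforms of measures on `[0, ∞)` with bounded
mass are again such transforms. In the coordinate `s = 1 / (1 + t)` the measures live on the
compact `[0, 1]` and the kernel is continuous and vanishes at `s = 0`, so mass escaping to `t = ∞`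
is harmless. -/
theorem exists_spectralIntegral_eq_of_tendsto {ι : Type*} {l : Filter ι} [NeBot l]
    {σ : ι → Measure ℝ} (hs : ∀ i, σ i (Iio 0) = 0) {M : ℝ≥0} (hM : ∀ i, σ i univ ≤ M) {F : ℂ → ℂ}
    (hF : ∀ ζ : ℂ, 0 < ζ.im → Tendsto (fun i => spectralIntegral (σ i) ζ) l (𝓝 (F ζ))) :
    ∃ σ' : Measure ℝ, IsFiniteMeasure σ' ∧ σ' (Iio 0) = 0 ∧
      ∀ ζ : ℂ, 0 < ζ.im → F ζ = spectralIntegral σ' ζ := by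
  have hfin : ∀ i, IsFiniteMeasure (σ i) := fun i => ⟨(hM i).trans_lt ENNReal.coe_lt_top⟩
  let μ : ι → FiniteMeasure (Icc (0 : ℝ) 1) := fun i =>
    ⟨(σ i).map compactChart, inferInstance⟩
  have hμ : ∀ i, (μ i : Measure (Icc (0 : ℝ) 1)) = (σ i).map compactChart := fun i => rfl
  have hμM : ∀ i, (μ i).mass ≤ M := fun i => by
    rw [← ENNReal.coe_le_coe, FiniteMeasure.ennreal_mass, hμ,
      Measure.map_apply continuous_compactChart.measurable MeasurableSet.univ, preimage_univ]
    exact hM i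
  let U : Ultrafilter ι := Ultrafilter.of l
  obtain ⟨ν, -, hν⟩ := (isCompact_setOfPred_finiteMeasure_le_of_compactSpace
    (Icc (0 : ℝ) 1) M).ultrafilter_le_nhds (U.map μ) (by
      rw [Filter.le_principal_iff]
      exact Filter.mem_map.2 (Filter.univ_mem' hμM))
  have hν' : Tendsto μ U (𝓝 ν) := hν
  rw [FiniteMeasure.tendsto_iff_forall_integral_rclike_tendsto ℂ] at hν'
  let S : Set (Icc (0 : ℝ) 1) := {s | (s : ℝ) ≠ 0}
  have hS : MeasurableSet S :=
    (measurableSet_singleton (0 : ℝ)).compl.preimage measurable_subtype_coe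
  let g : Icc (0 : ℝ) 1 → ℝ := fun s => (s : ℝ)⁻¹ - 1
  have hg : Measurable g := by fun_prop
  -- An atom of the limit at `s = 0` is dropped; the kernel vanishes there.
  refine ⟨((ν : Measure (Icc (0 : ℝ) 1)).restrict S).map g, inferInstance, ?_, fun ζ hζ => ?_⟩
  · rw [Measure.map_apply hg measurableSet_Iio]
    rw [Measure.restrict_apply (hg measurableSet_Iio)]
    convert measure_empty (μ := (ν : Measure (Icc (0 : ℝ) 1)))
    refine eq_empty_of_forall_notMem fun s hs => ?_
    have h1 : (s : ℝ)⁻¹ - 1 < 0 := hs.1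
    have h2 : 0 < (s : ℝ) := lt_of_le_of_ne s.2.1 (Ne.symm hs.2)
    linarith [(one_le_inv₀ h2).2 s.2.2]
  · have h1 := hν' (BoundedContinuousFunction.mkOfCompact ⟨_, continuous_chartKernel hζ⟩)
    have h2 : ∀ i, ∫ s, chartKernel ζ s ∂(μ i : Measure (Icc (0 : ℝ) 1))
        = spectralIntegral (σ i) ζ := by
      intro i
      rw [hμ, integral_map continuous_compactChart.aemeasurable
        (continuous_chartKernel hζ).aestronglyMeasurable]
      exact integral_congr_ae ((ae_nonneg_of_support (hs i)).mono fun t ht =>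
        chartKernel_compactChart ht)
    simp only [BoundedContinuousFunction.mkOfCompact_apply, ContinuousMap.coe_mk, h2] at h1
    have h3 := tendsto_nhds_unique ((hF ζ hζ).mono_left (Ultrafilter.of_le l)) h1
    rw [h3, spectralIntegral, integral_map hg.aemeasurable
      (measurable_kernel ζ).aestronglyMeasurable]
    have h4 : ∫ s in S, ((g s : ℂ) - ζ ^ 2)⁻¹ ∂(ν : Measure (Icc (0 : ℝ) 1))
        = ∫ s in S, chartKernel ζ s ∂(ν : Measure (Icc (0 : ℝ) 1)) :=
      setIntegral_congr_fun hS fun s hs => (chartKernel_eq hs).symm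
    rw [h4, setIntegral_eq_integral_of_forall_compl_eq_zero fun s hs => ?_]
    have : (s : ℝ) = 0 := by simpa [S] using hs
    simp [chartKernel, this]

/-- The image under `x ↦ x²` of the measure `(2 / π) x p(x) dx` on `(0, ∞)`, the spectral measure
with boundary imaginary part `p`. Negative values of `p` count as zero. -/
def quadMeasure (p : ℝ → ℝ) : Measure ℝ :=
  ((volume.restrict (Ioi 0)).withDensity
    fun x => ENNReal.ofReal (2 / Real.pi * (x * p x))).map fun x => x ^ 2

theorem quadMeasure_Iio (p : ℝ → ℝ) : quadMeasure p (Iio 0) = 0 := by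
  rw [quadMeasure, Measure.map_apply (by fun_prop) measurableSet_Iio]
  have : (fun x : ℝ => x ^ 2) ⁻¹' Iio 0 = ∅ := by
    ext x; simp [sq_nonneg]
  rw [this, measure_empty]

theorem lintegral_quadMeasure {p : ℝ → ℝ} (hp : Measurable p) {k : ℝ → ℝ≥0∞} (hk : Measurable k) :
    ∫⁻ t, k t ∂quadMeasure p
      = ∫⁻ x in Ioi (0 : ℝ), ENNReal.ofReal (2 / Real.pi * (x * p x)) * k (x ^ 2) := by
  rw [quadMeasure, lintegral_map hk (by fun_prop),
    lintegral_withDensity_eq_lintegral_mul _ (by fun_prop)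
      (by fun_prop : Measurable fun x : ℝ => k (x ^ 2))]
  rfl

theorem integral_quadMeasure {p : ℝ → ℝ} (hp : Measurable p) (hp0 : ∀ x, 0 < x → 0 ≤ p x)
    {k : ℝ → ℂ} (hk : Measurable k) :
    ∫ t, k t ∂quadMeasure p
      = ∫ x in Ioi (0 : ℝ), ((2 / Real.pi * (x * p x) : ℝ) : ℂ) * k (x ^ 2) := by
  rw [quadMeasure, integral_map (by fun_prop) hk.aestronglyMeasurable,
    integral_withDensity_eq_integral_toReal_smul (by fun_prop) (by simp)]
  refine setIntegral_congr_fun measurableSet_Ioi fun x (hx : 0 < x) => ?_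
  have := hp0 x hx
  rw [ENNReal.toReal_ofReal (by positivity), Complex.real_smul]

/-- The total mass is the limit of `∫ y² / (t + y²) dσ(t)` as `y → ∞`. -/
theorem measure_univ_le_of_lintegral_le {σ : Measure ℝ} (hs : σ (Iio 0) = 0) {B : ℝ≥0∞}
    (hB : ∀ᶠ y : ℝ in atTop, ∫⁻ t, ENNReal.ofReal (y ^ 2 * (t + y ^ 2)⁻¹) ∂σ ≤ B) :
    σ univ ≤ B := by
  have hB' : ∀ᶠ n : ℕ in atTop, ∫⁻ t, ENNReal.ofReal ((n : ℝ) ^ 2 * (t + (n : ℝ) ^ 2)⁻¹) ∂σ ≤ B :=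
    tendsto_natCast_atTop_atTop.eventually hB
  have hlim : ∀ᵐ t ∂σ,
      liminf (fun n : ℕ => ENNReal.ofReal ((n : ℝ) ^ 2 * (t + (n : ℝ) ^ 2)⁻¹)) atTop
      = 1 := by
    filter_upwards [ae_nonneg_of_support hs] with t ht
    refine Tendsto.liminf_eq ?_
    rw [← ENNReal.ofReal_one]
    refine (ENNReal.continuous_ofReal.tendsto 1).comp ?_
    have h1 : Tendsto (fun n : ℕ => 1 - t * (t + (n : ℝ) ^ 2)⁻¹) atTop (𝓝 (1 - t * 0)) := by
      refine tendsto_const_nhds.sub (Tendsto.const_mul t (tendsto_inv_atTop_zero.comp ?_))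
      refine tendsto_atTop_add_const_left _ _ ?_
      exact (tendsto_pow_atTop (by norm_num)).comp tendsto_natCast_atTop_atTop
    rw [mul_zero, sub_zero] at h1
    refine h1.congr' ?_
    filter_upwards [eventually_gt_atTop 0] with n hn
    have : (0 : ℝ) < n := by exact_mod_cast hn
    have : t + (n : ℝ) ^ 2 ≠ 0 := by positivity
    field_simp
    ring
  calc σ univ = ∫⁻ _, 1 ∂σ := by simp
    _ = ∫⁻ t, liminf (fun n : ℕ => ENNReal.ofReal ((n : ℝ) ^ 2 * (t + (n : ℝ) ^ 2)⁻¹)) atTop ∂σ :=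
        lintegral_congr_ae (hlim.mono fun t ht => ht.symm)
    _ ≤ liminf (fun n : ℕ => ∫⁻ t, ENNReal.ofReal ((n : ℝ) ^ 2 * (t + (n : ℝ) ^ 2)⁻¹) ∂σ) atTop :=
        lintegral_liminf_le fun n => by fun_prop
    _ ≤ B := by
        refine liminf_le_of_frequently_le' hB'.frequently

/-! ### Existence of the spectral measure -/

theorem continuous_ofReal_of_differentiableOn {ψ : ℂ → ℂ}
    (hψ : DifferentiableOn ℂ ψ {w | 0 ≤ w.im}) :
    Continuous fun x : ℝ => ψ x :=
  hψ.continuousOn.comp_continuous Complex.continuous_ofReal (fun x => by simp)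

theorem eq_spectralIntegral_quadMeasure {ψ : ℂ → ℂ} {C : ℝ}
    (hψ : DifferentiableOn ℂ ψ {w | 0 ≤ w.im})
    (hb : ∀ w : ℂ, 0 ≤ w.im → ‖ψ w‖ ≤ C / (1 + ‖w‖ ^ 2))
    (hsymm : ∀ x : ℝ, ψ (-x) = conj (ψ x)) (hpos : ∀ x : ℝ, 0 < x → 0 ≤ (ψ x).im)
    {ζ : ℂ} (hζ : 0 < ζ.im) :
    ψ ζ = spectralIntegral (quadMeasure fun x => (ψ x).im) ζ := by
  have hm : Measurable fun x : ℝ => (ψ x).im :=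
    (Complex.continuous_im.comp (continuous_ofReal_of_differentiableOn hψ)).measurable
  rw [spectralIntegral, integral_quadMeasure hm hpos (measurable_kernel ζ)]
  exact (eq_integral_im hψ hb hsymm hζ).2

theorem lintegral_quadMeasure_im {ψ : ℂ → ℂ} {C : ℝ}
    (hψ : DifferentiableOn ℂ ψ {w | 0 ≤ w.im})
    (hb : ∀ w : ℂ, 0 ≤ w.im → ‖ψ w‖ ≤ C / (1 + ‖w‖ ^ 2))
    (hsymm : ∀ x : ℝ, ψ (-x) = conj (ψ x)) (hpos : ∀ x : ℝ, 0 < x → 0 ≤ (ψ x).im)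
    {y : ℝ} (hy : 0 < y) :
    ∫⁻ t, ENNReal.ofReal (y ^ 2 * (t + y ^ 2)⁻¹) ∂(quadMeasure fun x => (ψ x).im)
      = ENNReal.ofReal (y ^ 2 * (ψ (Complex.I * y)).re) := by
  have hm : Measurable fun x : ℝ => (ψ x).im :=
    (Complex.continuous_im.comp (continuous_ofReal_of_differentiableOn hψ)).measurable
  obtain ⟨hint, heq⟩ := eq_integral_im hψ hb hsymm (ζ := Complex.I * y) (by simpa using hy)
  have e : ∀ x : ℝ, ((2 / Real.pi * (x * (ψ x).im) : ℝ) : ℂ) *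
      (((x ^ 2 : ℝ) : ℂ) - (Complex.I * y) ^ 2)⁻¹
      = ((2 / Real.pi * (x * (ψ x).im) * (x ^ 2 + y ^ 2)⁻¹ : ℝ) : ℂ) := fun x => by
    have : (((x ^ 2 : ℝ) : ℂ) - (Complex.I * y) ^ 2) = ((x ^ 2 + y ^ 2 : ℝ) : ℂ) := by
      rw [mul_pow, Complex.I_sq]; push_cast; ring
    rw [this]
    push_cast
    ring
  simp_rw [e] at hint heq
  have hint' : IntegrableOn (fun x : ℝ => 2 / Real.pi * (x * (ψ x).im) * (x ^ 2 + y ^ 2)⁻¹)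
      (Ioi 0) := hint.re
  rw [integral_complex_ofReal] at heq
  rw [heq, Complex.ofReal_re, lintegral_quadMeasure hm (by fun_prop), ← integral_const_mul,
    ofReal_integral_eq_lintegral_ofReal (hint'.const_mul _)]
  · refine setLIntegral_congr_fun measurableSet_Ioi fun x (hx : 0 < x) => ?_
    have := hpos x hx
    rw [← ENNReal.ofReal_mul (by positivity)]
    congr 1
    ring
  · filter_upwards [ae_restrict_mem measurableSet_Ioi] with x (hx : 0 < x)
    have := hpos x hx
    positivity

theorem ClassK.exists_bound_far {h : ℝ} {f : ℂ → ℂ} (hf : ClassK h f) :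
    ∃ R C : ℝ, 1 ≤ R ∧ 0 ≤ C ∧ ∀ ω ∈ halfPlane h, R ≤ ‖ω‖ → ‖f ω‖ ≤ C / ‖ω‖ ^ 2 := by
  obtain ⟨A, hA, hO⟩ := hf.plasma
  obtain ⟨C, hC, hO⟩ := hO.exists_nonneg
  have hO := hO.bound
  rw [eventually_inf_principal] at hO
  obtain ⟨R, -, hR⟩ := (Filter.hasBasis_cobounded_norm (E := ℂ)).eventually_iff.1 hO
  refine ⟨max R 1, A + C, le_max_right _ _, by positivity, fun ω hω hωR => ?_⟩
  have h1 : 1 ≤ ‖ω‖ := (le_max_right _ _).trans hωR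
  have h2 := hR ((le_max_left _ _).trans hωR : R ≤ ‖ω‖) hω
  have h3 : ‖(-(A : ℂ) * (ω ^ 2)⁻¹)‖ = A / ‖ω‖ ^ 2 := by
    rw [norm_mul, norm_neg, Complex.norm_real, Real.norm_of_nonneg hA.le, norm_inv, norm_pow]
    rfl
  have h4 : C * ‖(ω ^ 3)⁻¹‖ ≤ C / ‖ω‖ ^ 2 := by
    rw [norm_inv, norm_pow, ← div_eq_mul_inv]
    gcongr
    norm_num
  have h5 := norm_add_le (f ω - -(A : ℂ) * (ω ^ 2)⁻¹) (-(A : ℂ) * (ω ^ 2)⁻¹)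
  rw [sub_add_cancel, h3] at h5
  rw [add_div]
  linarith

/-- Every `f` in `K_h` has a spectral measure. The shifts `f(· + iδ)` are holomorphic across the
line `Im ω = -h`, hence are transforms of explicit densities; the decay `f = O(ω⁻²)` along the
imaginary axis bounds the masses of these densities uniformly, and a weak limit represents `f`. -/
theorem ClassK.exists_isSpectralMeasure {h : ℝ} (hh : 0 < h) {f : ℂ → ℂ} (hf : ClassK h f) :
    ∃ σ : Measure ℝ, IsSpectralMeasure h f σ := by
  obtain ⟨R, C, hR, hC, hfar⟩ := hf.exists_bound_far
  let δ : ℕ → ℝ := fun n => 1 / ((n : ℝ) + 1)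
  have hδ : ∀ n, 0 < δ n := fun n => by positivity
  let ψ : ℕ → ℂ → ℂ := fun n ζ => f (ζ + Complex.I * ((δ n - h : ℝ) : ℂ))
  have hmem : ∀ n, ∀ ζ : ℂ, 0 ≤ ζ.im → ζ + Complex.I * ((δ n - h : ℝ) : ℂ) ∈ halfPlane h := by
    intro n ζ hζ
    have := hδ n
    simp only [halfPlane, mem_ofPred_eq, Complex.add_im, Complex.mul_im, Complex.I_re,
      Complex.I_im, Complex.ofReal_re, Complex.ofReal_im]
    linarith
  have hψ : ∀ n, DifferentiableOn ℂ (ψ n) {w | 0 ≤ w.im} := fun n =>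
    hf.analytic.comp (by fun_prop) fun ζ hζ => hmem n ζ hζ
  have hb : ∀ n, ∃ C', ∀ w ∈ {w : ℂ | 0 ≤ w.im}, ‖ψ n w‖ ≤ C' / (1 + ‖w‖ ^ 2) := by
    intro n
    refine exists_bound_of_bound_far (isClosed_le continuous_const Complex.continuous_im)
      (hψ n).continuousOn (R := 2 * (R + |δ n - h|)) (C := C * 4) fun w hw hwR => ?_
    have hsh : ‖Complex.I * ((δ n - h : ℝ) : ℂ)‖ = |δ n - h| := by
      rw [norm_mul, Complex.norm_I, one_mul, Complex.norm_real, Real.norm_eq_abs]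
    have h1 := norm_sub_le_norm_add w (Complex.I * ((δ n - h : ℝ) : ℂ))
    rw [hsh] at h1
    have h0 := abs_nonneg (δ n - h)
    have hw0 : 0 < ‖w‖ := by linarith
    refine (hfar _ (hmem n w hw) (by linarith)).trans ?_
    calc C / ‖w + Complex.I * ((δ n - h : ℝ) : ℂ)‖ ^ 2 ≤ C / (‖w‖ / 2) ^ 2 := by
          gcongr; linarith
      _ = _ := by ring
  have hsymm : ∀ n, ∀ x : ℝ, ψ n (-x) = conj (ψ n x) := fun n x => by
    have h1 := hf.symm _ (hmem n (-x : ℝ) (by simp))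
    simp only [ψ]
    rw [← Complex.ofReal_neg, ← h1]
    simp [add_comm]
  have hpos : ∀ n, ∀ x : ℝ, 0 < x → 0 ≤ (ψ n x).im := fun n x hx =>
    (hf.passive _ (hmem n x (by simp)) (by simpa using hx)).le
  choose C' hb using hb
  let σ : ℕ → Measure ℝ := fun n => quadMeasure fun x => (ψ n x).im
  have hmass : ∀ n, σ n univ ≤ (Real.toNNReal (4 * C) : ℝ≥0∞) := fun n => by
    refine measure_univ_le_of_lintegral_le (quadMeasure_Iio _) ?_
    filter_upwards [eventually_ge_atTop (2 * (R + h))] with y hy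
    have hy0 : 0 < y := by linarith
    rw [lintegral_quadMeasure_im (hψ n) (hb n) (hsymm n) (hpos n) hy0]
    refine ENNReal.ofReal_le_ofReal ?_
    have hn : ‖Complex.I * (y : ℂ) + Complex.I * ((δ n - h : ℝ) : ℂ)‖ = y + (δ n - h) := by
      rw [← mul_add, norm_mul, Complex.norm_I, one_mul, ← Complex.ofReal_add, Complex.norm_real,
        Real.norm_of_nonneg (by linarith [hδ n])]
    have h1 := hfar _ (hmem n (Complex.I * y) (by simpa using hy0.le)) (by
      rw [hn]; linarith [hδ n])
    rw [hn] at h1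
    have h2 : (ψ n (Complex.I * y)).re ≤ C / (y / 2) ^ 2 :=
      (Complex.re_le_norm _).trans (h1.trans (by gcongr; linarith [hδ n]))
    calc y ^ 2 * (ψ n (Complex.I * y)).re ≤ y ^ 2 * (C / (y / 2) ^ 2) := by gcongr
      _ = 4 * C := by field_simp; norm_num
  have hlim : Tendsto δ atTop (𝓝 0) := tendsto_one_div_add_atTop_nhds_zero_nat
  obtain ⟨σ', hσf, hσs, hσ⟩ := exists_spectralIntegral_eq_of_tendsto (l := atTop) (σ := σ)
    (fun n => quadMeasure_Iio _) hmass (F := fun ζ => f (ζ - Complex.I * h)) fun ζ hζ => by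
      have h1 : ∀ n, spectralIntegral (σ n) ζ = ψ n ζ := fun n =>
        (eq_spectralIntegral_quadMeasure (hψ n) (hb n) (hsymm n) (hpos n) hζ).symm
      simp_rw [h1]
      have hm0 : ζ - Complex.I * h ∈ halfPlane h := by
        simpa [halfPlane] using hζ
      have hop : IsOpen (halfPlane h) := isOpen_lt continuous_const Complex.continuous_im
      have hc := (hf.analytic.continuousOn.continuousAt (hop.mem_nhds hm0)).tendsto
      refine hc.comp ?_
      have h2 : Tendsto (fun n => ζ + Complex.I * ((δ n - h : ℝ) : ℂ)) atTop
          (𝓝 (ζ + Complex.I * ((0 - h : ℝ) : ℂ))) := by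
        refine tendsto_const_nhds.add (Tendsto.const_mul _ ?_)
        exact (Complex.continuous_ofReal.tendsto _).comp (hlim.sub_const h)
      convert h2 using 2
      push_cast
      ring
  refine ⟨σ', hσf, hσs, fun ω hω => ?_⟩
  have := hσ (ω + Complex.I * h) (by
    have : -h < ω.im := hω
    simp; linarith)
  simpa [spectralIntegral] using this

theorem ClassK.isSpectralMeasure {h : ℝ} (hh : 0 < h) {f : ℂ → ℂ} (hf : ClassK h f) :
    IsSpectralMeasure h f (spectralMeasure h f) := by
  have H := hf.exists_isSpectralMeasure hh
  rw [spectralMeasure, dif_pos H]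
  exact H.choose_spec

/-- The point `i (1 - h)` of the half-plane, at which `ω + i h = i`. -/
def normPoint (h : ℝ) : ℂ := Complex.I * ((1 - h : ℝ) : ℂ)

theorem normPoint_mem (h : ℝ) : normPoint h ∈ halfPlane h := by
  simp [normPoint, halfPlane]

theorem normPoint_add (h : ℝ) : normPoint h + Complex.I * h = Complex.I := by
  simp only [normPoint]; push_cast; ring

/-- At `ω = i (1 - h)` the kernel is `1 / (t + 1)`, so `‖σ_f‖` is a value of `f`. In particular it
does not depend on the choice of the spectral measure. -/
theorem IsSpectralMeasure.eq_starNorm {h : ℝ} {f : ℂ → ℂ} {σ : Measure ℝ}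
    (hσ : IsSpectralMeasure h f σ) :
    starNorm σ = ENNReal.ofReal (f (normPoint h)).re := by
  have := hσ.finite
  have h1 := hσ.repr _ (normPoint_mem h)
  rw [normPoint_add] at h1
  change _ = spectralIntegral σ Complex.I at h1
  rw [h1, spectralIntegral_I, Complex.ofReal_re, starNorm]
  have hae := ae_nonneg_of_support hσ.support
  have hr : σ.restrict (Ici 0) = σ := Measure.restrict_eq_self_of_ae_mem hae
  rw [hr, ofReal_integral_eq_lintegral_ofReal]
  · simp
  · refine Integrable.of_bound (C := 1) (by fun_prop) ?_
    filter_upwards [hae] with t ht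
    rw [norm_inv, Real.norm_of_nonneg (by linarith)]
    exact inv_le_one_of_one_le₀ (by linarith)
  · filter_upwards [hae] with t ht
    simp only [Pi.zero_apply]
    positivity

theorem ClassK.starNorm_eq {h : ℝ} (hh : 0 < h) {f : ℂ → ℂ} (hf : ClassK h f) :
    starNorm (spectralMeasure h f) = ENNReal.ofReal (f (normPoint h)).re :=
  (hf.isSpectralMeasure hh).eq_starNorm

/-! ### Hardy norm of a difference of two transforms -/

theorem eLpNorm_two_sq {α : Type*} [MeasurableSpace α] (μ : Measure α) (F : α → ℂ) :
    eLpNorm F 2 μ ^ 2 = ∫⁻ x, ‖F x‖ₑ ^ 2 ∂μ := by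
  have := eLpNorm_nnreal_pow_eq_lintegral (f := F) (μ := μ) (p := 2) (by norm_num)
  simpa using this

theorem eLpNorm_two_le_iff {α : Type*} [MeasurableSpace α] {μ : Measure α} {F : α → ℂ} {c : ℝ≥0∞} :
    eLpNorm F 2 μ ≤ c ↔ ∫⁻ x, ‖F x‖ₑ ^ 2 ∂μ ≤ c ^ 2 := by
  rw [← eLpNorm_two_sq, ENNReal.pow_le_pow_left_iff two_ne_zero]

theorem integral_lorentzian (a : ℝ) {η : ℝ} (hη : 0 < η) :
    Integrable (fun x : ℝ => ((x - a) ^ 2 + η ^ 2)⁻¹) ∧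
    ∫ x : ℝ, ((x - a) ^ 2 + η ^ 2)⁻¹ = Real.pi / η := by
  have e : (fun x : ℝ => ((x - a) ^ 2 + η ^ 2)⁻¹)
      = fun x => (η ^ 2)⁻¹ * (1 + ((x - a) / η) ^ 2)⁻¹ := by
    ext x; field_simp; ring
  rw [e]
  refine ⟨Integrable.const_mul ?_ _, ?_⟩
  · exact (integrable_inv_one_add_sq.comp_div hη.ne').comp_sub_right a
  · rw [integral_const_mul, integral_sub_right_eq_self (fun x : ℝ => (1 + (x / η) ^ 2)⁻¹) a,
      Measure.integral_comp_div (fun x : ℝ => (1 + x ^ 2)⁻¹) η,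
      integral_univ_inv_one_add_sq, abs_of_pos hη, smul_eq_mul]
    field_simp

/-- Partial fractions: `(1 + t) / (ζ (t - ζ²)) = 1/ζ + ζ/(t - ζ²) + 1/(ζ (t - ζ²))`. The division
by `ζ` makes the weight `1 + t` affordable uniformly in `t`; without it the `L²` norm of the
kernel on a horizontal line decays only like `t ^ (-1/2)`. -/
theorem kernel_div_le {t : ℝ} (ht : 0 ≤ t) {d : ℝ} (hd : 0 < d) {ζ : ℂ} (hζ : d ≤ ζ.im) :
    (1 + t) * ‖((t : ℂ) - ζ ^ 2)⁻¹‖ / ‖ζ‖ ≤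
      (1 + (d ^ 2)⁻¹) * ‖ζ‖⁻¹ + (‖(√t : ℂ) - ζ‖⁻¹ + ‖(√t : ℂ) + ζ‖⁻¹) / 2 := by
  have him : 0 < ζ.im := hd.trans_le hζ
  have hne := sub_sq_ne_zero ht him
  have hζ0 : ζ ≠ 0 := by rintro rfl; simp at him
  have hst : ((√t : ℝ) : ℂ) ^ 2 = t := by exact_mod_cast Real.sq_sqrt ht
  have hfac : (t : ℂ) - ζ ^ 2 = ((√t : ℂ) - ζ) * ((√t : ℂ) + ζ) := by rw [← hst]; ring
  have hne1 : (√t : ℂ) - ζ ≠ 0 := fun h => hne (by rw [hfac, h, zero_mul])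
  have hne2 : (√t : ℂ) + ζ ≠ 0 := fun h => hne (by rw [hfac, h, mul_zero])
  have e : (1 + (t : ℂ)) * ((t : ℂ) - ζ ^ 2)⁻¹ / ζ
      = ζ⁻¹ + ((t : ℂ) - ζ ^ 2)⁻¹ * ζ⁻¹ + (((√t : ℂ) - ζ)⁻¹ - ((√t : ℂ) + ζ)⁻¹) / 2 := by
    have e1 : (((√t : ℂ) - ζ)⁻¹ - ((√t : ℂ) + ζ)⁻¹) / 2 = ζ / ((t : ℂ) - ζ ^ 2) := by
      rw [hfac]; field_simp; ring
    rw [e1]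
    field_simp
    ring
  have hn : (1 + t) * ‖((t : ℂ) - ζ ^ 2)⁻¹‖ / ‖ζ‖ = ‖(1 + (t : ℂ)) * ((t : ℂ) - ζ ^ 2)⁻¹ / ζ‖ := by
    have : ‖1 + (t : ℂ)‖ = 1 + t := by
      rw [← Complex.ofReal_one, ← Complex.ofReal_add, Complex.norm_real,
        Real.norm_of_nonneg (by positivity)]
    rw [norm_div, norm_mul, this]
  rw [hn, e]
  have hk : ‖((t : ℂ) - ζ ^ 2)⁻¹‖ ≤ (d ^ 2)⁻¹ := (norm_kernel_le ht him).trans (by gcongr)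
  refine (norm_add_le _ _).trans (add_le_add ((norm_add_le _ _).trans ?_) ?_)
  · rw [norm_mul, norm_inv ζ, add_mul, one_mul]
    gcongr
  · rw [norm_div, Complex.norm_ofNat, ← norm_inv, ← norm_inv]
    gcongr
    exact norm_sub_le _ _

/-- A bound for the squared `L²` norm of the weighted kernel on lines at height at least `d`. -/
def kernelConst (d : ℝ) : ℝ := 3 * ((1 + (d ^ 2)⁻¹) ^ 2 + 1 / 2) * (Real.pi / d)

/-- The square norm on a horizontal line of the kernel weighted as in `kernel_div_le`, uniformly
in `t`. -/
theorem lintegral_kernel_sq_le {t : ℝ} (ht : 0 ≤ t) {d η : ℝ} (hd : 0 < d) (hη : d ≤ η) :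
    ∫⁻ x : ℝ, ENNReal.ofReal ((1 + t) * ‖((t : ℂ) - ((x : ℂ) + Complex.I * η) ^ 2)⁻¹‖ /
      ‖(x : ℂ) + Complex.I * η‖) ^ 2 ≤ ENNReal.ofReal (kernelConst d) := by
  have hη0 : 0 < η := hd.trans_le hη
  let Q : ℝ → ℝ → ℝ := fun a x => ((x - a) ^ 2 + η ^ 2)⁻¹
  have hQ : ∀ a, Integrable (Q a) := fun a => (integral_lorentzian a hη0).1
  have hQi : ∀ a, ∫ x, Q a x = Real.pi / η := fun a => (integral_lorentzian a hη0).2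
  have hnorm : ∀ w : ℂ, ‖w‖⁻¹ ^ 2 = (w.re ^ 2 + w.im ^ 2)⁻¹ := fun w => by
    rw [inv_pow, Complex.sq_norm, Complex.normSq_apply, sq, sq]
  let B : ℝ → ℝ := fun x =>
    3 * ((1 + (d ^ 2)⁻¹) ^ 2 * Q 0 x + (1 / 4) * Q (√t) x + (1 / 4) * Q (-√t) x)
  have hB : ∀ x : ℝ, ((1 + t) * ‖((t : ℂ) - ((x : ℂ) + Complex.I * η) ^ 2)⁻¹‖ /
      ‖(x : ℂ) + Complex.I * η‖) ^ 2 ≤ B x := fun x => by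
    have h1 := kernel_div_le ht hd (ζ := (x : ℂ) + Complex.I * η) (by simpa using hη)
    refine (pow_le_pow_left₀ (by positivity) h1 2).trans ?_
    have e0 : ‖(x : ℂ) + Complex.I * η‖⁻¹ ^ 2 = Q 0 x := by simp [hnorm, Q]
    have e1 : ‖(√t : ℂ) - ((x : ℂ) + Complex.I * η)‖⁻¹ ^ 2 = Q (√t) x := by
      simp only [hnorm, Q]; simp; ring
    have e2 : ‖(√t : ℂ) + ((x : ℂ) + Complex.I * η)‖⁻¹ ^ 2 = Q (-√t) x := by
      simp only [hnorm, Q]; simp; ring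
    simp only [B, ← e0, ← e1, ← e2]
    generalize ‖(x : ℂ) + Complex.I * η‖⁻¹ = u
    generalize ‖(√t : ℂ) - ((x : ℂ) + Complex.I * η)‖⁻¹ = v
    generalize ‖(√t : ℂ) + ((x : ℂ) + Complex.I * η)‖⁻¹ = w
    generalize 1 + (d ^ 2)⁻¹ = b
    nlinarith [sq_nonneg (b * u - v / 2), sq_nonneg (b * u - w / 2), sq_nonneg (v - w)]
  have hBint : Integrable B :=
    ((((hQ 0).const_mul _).add ((hQ _).const_mul _)).add ((hQ _).const_mul _)).const_mul _
  calc _ ≤ ∫⁻ x : ℝ, ENNReal.ofReal (B x) := by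
        refine lintegral_mono fun x => ?_
        rw [← ENNReal.ofReal_pow (by positivity)]
        exact ENNReal.ofReal_le_ofReal (hB x)
    _ = ENNReal.ofReal (∫ x, B x) :=
        (ofReal_integral_eq_lintegral_ofReal hBint
          (ae_of_all _ fun x => (sq_nonneg _).trans (hB x))).symm
    _ ≤ _ := by
        refine ENNReal.ofReal_le_ofReal ?_
        simp only [B]
        have hQ' : Integrable fun x => (1 + (d ^ 2)⁻¹) ^ 2 * Q 0 x + 1 / 4 * Q (√t) x :=
          ((hQ 0).const_mul _).add ((hQ _).const_mul _)
        rw [integral_const_mul, integral_add hQ' ((hQ _).const_mul _),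
          integral_add ((hQ 0).const_mul _) ((hQ _).const_mul _), integral_const_mul,
          integral_const_mul, integral_const_mul, hQi, hQi, hQi, kernelConst]
        have : Real.pi / η ≤ Real.pi / d := by gcongr
        have h2 : 0 ≤ (1 + (d ^ 2)⁻¹) ^ 2 := sq_nonneg _
        nlinarith

/-- The Cauchy–Schwarz inequality against the constant `1`. -/
theorem sq_lintegral_le {α : Type*} [MeasurableSpace α] (τ : Measure α) {κ : α → ℝ≥0∞}
    (hκ : AEMeasurable κ τ) : (∫⁻ t, κ t ∂τ) ^ 2 ≤ τ univ * ∫⁻ t, κ t ^ 2 ∂τ := by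
  have h := ENNReal.lintegral_mul_le_Lp_mul_Lq τ (p := 2) (q := 2) (by constructor <;> norm_num)
    hκ (g := fun _ => 1) aemeasurable_const
  simp only [Pi.mul_apply, mul_one, ENNReal.one_rpow, lintegral_one] at h
  calc (∫⁻ t, κ t ∂τ) ^ 2
      ≤ ((∫⁻ t, κ t ^ (2 : ℝ) ∂τ) ^ (1 / 2 : ℝ) * (τ univ) ^ (1 / 2 : ℝ)) ^ 2 := by
        gcongr
    _ = _ := by
        rw [mul_pow, ← ENNReal.rpow_natCast, ← ENNReal.rpow_natCast, ← ENNReal.rpow_mul,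
          ← ENNReal.rpow_mul]
        norm_num [mul_comm]

/-- The measure `dν(t) / (t + 1)`, of total mass `‖ν‖`. -/
def weighted (ν : Measure ℝ) : Measure ℝ :=
  (ν.restrict (Ici 0)).withDensity fun t => ENNReal.ofReal (1 / (t + 1))

theorem weighted_univ (ν : Measure ℝ) : weighted ν univ = starNorm ν := by
  rw [weighted, withDensity_apply _ MeasurableSet.univ, Measure.restrict_univ, starNorm]

theorem starNorm_le (ν : Measure ℝ) : starNorm ν ≤ ν univ := by
  calc starNorm ν ≤ ∫⁻ _ in Ici (0 : ℝ), 1 ∂ν := by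
        refine setLIntegral_mono' measurableSet_Ici fun t (ht : 0 ≤ t) => ?_
        rw [← ENNReal.ofReal_one]
        refine ENNReal.ofReal_le_ofReal ?_
        rw [div_le_one (by positivity)]
        linarith
    _ ≤ ν univ := by
        rw [setLIntegral_one]
        exact measure_mono (subset_univ _)

theorem ae_weighted (ν : Measure ℝ) : ∀ᵐ t ∂weighted ν, 0 ≤ t :=
  (withDensity_absolutelyContinuous _ _).ae_le (ae_restrict_mem measurableSet_Ici)

theorem lintegral_weighted {ν : Measure ℝ} (hν : ν (Iio 0) = 0) {k : ℝ → ℝ} (hk : Measurable k) :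
    ∫⁻ t, ENNReal.ofReal ((1 + t) * k t) ∂weighted ν = ∫⁻ t, ENNReal.ofReal (k t) ∂ν := by
  have hr : ν.restrict (Ici 0) = ν :=
    Measure.restrict_eq_self_of_ae_mem (ae_nonneg_of_support hν)
  rw [weighted, hr, lintegral_withDensity_eq_lintegral_mul _ (by fun_prop) (by fun_prop)]
  refine lintegral_congr_ae ((ae_nonneg_of_support hν).mono fun t ht => ?_)
  simp only [Pi.mul_apply]
  rw [← ENNReal.ofReal_mul (by positivity)]
  congr 1
  have : t + 1 ≠ 0 := by positivity
  field_simp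
  ring

/-- After division by `ζ = ω + i h`, a difference of two transforms is square integrable on every
horizontal line above the support, with a bound by the weighted norms of the measures. -/
theorem lintegral_spectralIntegral_sub_sq_le {σ₁ σ₂ : Measure ℝ} [IsFiniteMeasure σ₁]
    [IsFiniteMeasure σ₂] (h₁ : σ₁ (Iio 0) = 0) (h₂ : σ₂ (Iio 0) = 0) {d η : ℝ} (hd : 0 < d)
    (hη : d ≤ η) :
    ∫⁻ x : ℝ, ‖(spectralIntegral σ₁ (x + Complex.I * η) - spectralIntegral σ₂ (x + Complex.I * η)) /
      (x + Complex.I * η)‖ₑ ^ 2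
      ≤ (starNorm σ₁ + starNorm σ₂) ^ 2 * ENNReal.ofReal (kernelConst d) := by
  let ν := σ₁ + σ₂
  have hν : ν (Iio 0) = 0 := by simp [ν, h₁, h₂]
  have hνn : starNorm ν = starNorm σ₁ + starNorm σ₂ := by
    simp [ν, starNorm, Measure.restrict_add]
  let τ := weighted ν
  have : IsFiniteMeasure τ := by
    refine ⟨?_⟩
    rw [weighted_univ]
    exact (starNorm_le ν).trans_lt (measure_lt_top ν _)
  let κ : ℝ → ℝ → ℝ := fun x t => ‖((t : ℂ) - ((x : ℂ) + Complex.I * η) ^ 2)⁻¹‖ /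
      ‖(x : ℂ) + Complex.I * η‖
  have hη0 : 0 < η := hd.trans_le hη
  have hpt : ∀ x : ℝ, ‖(spectralIntegral σ₁ (x + Complex.I * η) -
      spectralIntegral σ₂ (x + Complex.I * η)) / (x + Complex.I * η)‖ₑ
      ≤ ∫⁻ t, ENNReal.ofReal ((1 + t) * κ x t) ∂τ := fun x => by
    set ζ : ℂ := x + Complex.I * η with hζ
    have hζi : 0 < ζ.im := by simpa [hζ] using hη0
    have hκm : Measurable (κ x) := by fun_prop
    have hζ0 : ζ ≠ 0 := by intro h; rw [h] at hζi; simp at hζi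
    rw [lintegral_weighted hν hκm, lintegral_add_measure]
    have key : ∀ (σ : Measure ℝ),
        ‖spectralIntegral σ ζ / ζ‖ₑ ≤ ∫⁻ t, ENNReal.ofReal (κ x t) ∂σ := by
      intro σ
      have e : spectralIntegral σ ζ / ζ = ∫ t : ℝ, ((t : ℂ) - ζ ^ 2)⁻¹ / ζ ∂σ := by
        rw [integral_div, spectralIntegral]
      rw [e]
      refine (enorm_integral_le_lintegral_enorm _).trans (lintegral_mono fun t => ?_)
      rw [← ofReal_norm, norm_div]
    rw [sub_div]
    exact (enorm_sub_le).trans (add_le_add (key _) (key _))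
  have hjm : Measurable (Function.uncurry fun x t : ℝ => ENNReal.ofReal ((1 + t) * κ x t) ^ 2) := by
    simp only [κ, Function.uncurry_def]
    fun_prop
  calc _ ≤ ∫⁻ x : ℝ, τ univ * ∫⁻ t, ENNReal.ofReal ((1 + t) * κ x t) ^ 2 ∂τ := by
        refine lintegral_mono fun x => ?_
        refine (pow_le_pow_left₀ (by positivity) (hpt x) 2).trans (sq_lintegral_le τ ?_)
        simp only [κ]
        fun_prop
    _ = τ univ * ∫⁻ t, (∫⁻ x : ℝ, ENNReal.ofReal ((1 + t) * κ x t) ^ 2) ∂τ := by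
        rw [lintegral_const_mul' _ _ (measure_ne_top _ _),
          lintegral_lintegral_swap hjm.aemeasurable]
    _ ≤ τ univ * ∫⁻ t, ENNReal.ofReal (kernelConst d) ∂τ := by
        gcongr 1
        refine lintegral_mono_ae ((ae_weighted ν).mono fun t ht => ?_)
        simpa only [κ, mul_div_assoc] using lintegral_kernel_sq_le ht hd hη
    _ = _ := by
        rw [lintegral_const, weighted_univ, hνn]
        ring

/-! ### Bounding the extrapolation error by the Hardy problem -/

theorem l2Norm_symm_sq_le {F : ℂ → ℂ} (hF : ∀ x : ℝ, ‖F (-x)‖ = ‖F x‖) :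
    l2Norm (-1) 1 F ^ 2 ≤ 2 * l2Norm 0 1 F ^ 2 := by
  rw [l2Norm, l2Norm, eLpNorm_two_sq, eLpNorm_two_sq]
  have hsub : Ioo (-1 : ℝ) 1 ⊆ Ioo (-1) 0 ∪ ({0} ∪ Ioo 0 1) := fun x hx => by
    rcases lt_trichotomy x 0 with h | h | h
    · exact Or.inl ⟨hx.1, h⟩
    · exact Or.inr (Or.inl h)
    · exact Or.inr (Or.inr ⟨h, hx.2⟩)
  have hneg : ∫⁻ x in Ioo (-1 : ℝ) 0, ‖F x‖ₑ ^ 2 = ∫⁻ x in Ioo (0 : ℝ) 1, ‖F x‖ₑ ^ 2 := by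
    have h1 := (Measure.measurePreserving_neg (volume : Measure ℝ)).setLIntegral_comp_preimage_emb
      (MeasurableEquiv.neg ℝ).measurableEmbedding (fun x : ℝ => ‖F x‖ₑ ^ 2) (Ioo (0 : ℝ) 1)
    rw [← h1]
    have : Neg.neg ⁻¹' Ioo (0 : ℝ) 1 = Ioo (-1) 0 := by ext x; simp [and_comm, neg_lt]
    rw [this]
    refine lintegral_congr fun x => ?_
    rw [Complex.ofReal_neg, ← ofReal_norm, ← ofReal_norm, hF]
  calc ∫⁻ x in Ioo (-1 : ℝ) 1, ‖F x‖ₑ ^ 2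
      ≤ ∫⁻ x in Ioo (-1 : ℝ) 0 ∪ ({0} ∪ Ioo 0 1), ‖F x‖ₑ ^ 2 := lintegral_mono_set hsub
    _ ≤ (∫⁻ x in Ioo (-1 : ℝ) 0, ‖F x‖ₑ ^ 2) + ((∫⁻ x in ({0} : Set ℝ), ‖F x‖ₑ ^ 2)
        + ∫⁻ x in Ioo (0 : ℝ) 1, ‖F x‖ₑ ^ 2) :=
        (lintegral_union_le _ _ _).trans (add_le_add le_rfl (lintegral_union_le _ _ _))
    _ = _ := by
        rw [hneg, Measure.restrict_singleton]
        simp [two_mul]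

theorem spectralMeasure_ne_zero {h : ℝ} (hh : 0 < h) {f : ℂ → ℂ} (hf : ClassK h f) :
    spectralMeasure h f ≠ 0 := fun h0 => by
  have hm : (1 : ℂ) ∈ halfPlane h := by simpa [halfPlane] using hh
  have h1 := hf.passive 1 hm (by simp)
  have h2 := (hf.isSpectralMeasure hh).repr 1 hm
  rw [h0, integral_zero_measure] at h2
  rw [h2] at h1
  simp at h1

theorem starNorm_ne_zero {σ : Measure ℝ} (hs : σ (Iio 0) = 0) (hne : σ ≠ 0) : starNorm σ ≠ 0 := by
  intro h0
  have hae := ae_nonneg_of_support hs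
  have hr : σ.restrict (Ici 0) = σ := Measure.restrict_eq_self_of_ae_mem hae
  rw [starNorm, hr, lintegral_eq_zero_iff (by fun_prop)] at h0
  have hF : ∀ᵐ _ : ℝ ∂σ, False := by
    filter_upwards [h0, hae] with t h1 h2
    have h3 : 1 / (t + 1) ≤ 0 := ENNReal.ofReal_eq_zero.1 h1
    have : 0 < 1 / (t + 1) := by positivity
    linarith
  exact hne (ae_eq_bot.1 (Filter.eventually_false_iff_eq_bot.1 hF))

theorem pairNorm_ne_zero {h : ℝ} (hh : 0 < h) {f g : ℂ → ℂ} (hf : ClassK h f) :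
    pairNorm h f g ≠ 0 := by
  have h1 := starNorm_ne_zero (hf.isSpectralMeasure hh).support (spectralMeasure_ne_zero hh hf)
  exact (lt_max_of_lt_left (pos_iff_ne_zero.2 h1)).ne'

theorem pairNorm_ne_top {h : ℝ} (hh : 0 < h) {f g : ℂ → ℂ} (hf : ClassK h f) (hg : ClassK h g) :
    pairNorm h f g ≠ ∞ := by
  rw [pairNorm, hf.starNorm_eq hh, hg.starNorm_eq hh]
  exact (max_lt ENNReal.ofReal_lt_top ENNReal.ofReal_lt_top).ne

/-- A normalized difference `(f - g) / M` of members of `K_h`, multiplied by `i c / (ω + i h)`, is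
admissible in the Hardy problem on the smaller half-plane `Im ω > -h'`. The factor `i` preserves
the symmetry, and the multiplier is bounded above and below on the interval and at `ω₀`. -/
theorem worstError_le_hardyError {h h' : ℝ} (hh' : 0 < h') (hlt : h' < h) (ω₀ : ℝ) :
    ∃ C : ℝ≥0, 0 < C ∧ ∀ ε : ℝ, worstError ω₀ h ε ≤ C * hardyError ω₀ h' ε := by
  have hh : 0 < h := hh'.trans hlt
  have hd : 0 < h - h' := by linarith
  set K := kernelConst (h - h') with hK
  have hK0 : 0 < K := by
    rw [hK, kernelConst]
    have := Real.pi_pos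
    positivity
  -- `c² · 4K ≤ 1` normalizes the Hardy norm, `c² · 2/h² ≤ 1` the norm on `(-1, 1)`.
  set c : ℝ := √((4 * K + 2 / h ^ 2)⁻¹) with hc
  have hc0 : 0 < c := Real.sqrt_pos.2 (by positivity)
  have hc2 : c ^ 2 = (4 * K + 2 / h ^ 2)⁻¹ := Real.sq_sqrt (by positivity)
  have hcK : c ^ 2 * (4 * K) ≤ 1 := by
    rw [hc2, inv_mul_le_one₀ (by positivity)]
    have : 0 < 2 / h ^ 2 := by positivity
    linarith
  have hch : c ^ 2 * (2 / h ^ 2) ≤ 1 := by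
    rw [hc2, inv_mul_le_one₀ (by positivity)]
    linarith
  have hζ₀ : 0 < ‖(ω₀ : ℂ) + Complex.I * h‖ := norm_pos_iff.2 fun h0 => by
    have := congrArg Complex.im h0
    simp at this
    linarith
  refine ⟨(‖(ω₀ : ℂ) + Complex.I * h‖ / c).toNNReal, by simp; positivity, fun ε => ?_⟩
  refine iSup₂_le fun p hp => ?_
  obtain ⟨hf, hg, hε⟩ := hp
  obtain ⟨f, g⟩ := p
  simp only at hf hg hε ⊢
  have hMne := pairNorm_ne_zero hh hf (g := g)
  have hMtop := pairNorm_ne_top hh hf hg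
  set M : ℝ := (pairNorm h f g).toReal with hM
  have hM0 : 0 < M := ENNReal.toReal_pos hMne hMtop
  have hMe : pairNorm h f g = ENNReal.ofReal M := (ENNReal.ofReal_toReal hMtop).symm
  rw [hMe] at hε ⊢
  let φ : ℂ → ℂ := fun ω => (c / M : ℝ) * Complex.I * ((f ω - g ω) / (ω + Complex.I * h))
  have him : ∀ ω ∈ halfPlane h', h - h' < (ω + Complex.I * h).im := fun ω hω => by
    have : -h' < ω.im := hω
    simp; linarith
  have hsub : ∀ ω ∈ halfPlane h', ω ∈ halfPlane h := fun ω hω => by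
    have : -h' < ω.im := hω
    change -h < ω.im
    linarith
  have hne : ∀ ω ∈ halfPlane h', ω + Complex.I * h ≠ 0 := fun ω hω h0 => by
    have := him ω hω
    rw [h0] at this
    simp at this
    linarith
  have hnorm : ∀ ω, ‖φ ω‖ₑ = ENNReal.ofReal (c / M) * ‖(f ω - g ω) / (ω + Complex.I * h)‖ₑ := by
    intro ω
    simp only [φ]
    rw [enorm_mul, enorm_mul, ← ofReal_norm, ← ofReal_norm Complex.I, Complex.norm_I,
      Complex.norm_real, Real.norm_of_nonneg (by positivity)]
    simp
  have hdiff : DifferentiableOn ℂ φ (halfPlane h') := by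
    refine DifferentiableOn.const_mul (DifferentiableOn.div ?_ (by fun_prop) hne) _
    exact (hf.analytic.mono hsub).sub (hg.analytic.mono hsub)
  have hsymm : IsSymm h' φ := fun ω hω => by
    have h1 := hf.symm ω (hsub ω hω)
    have h2 := hg.symm ω (hsub ω hω)
    simp only [φ]
    simp only [map_mul, map_div₀, map_sub, h1, h2, Complex.conj_ofReal, Complex.conj_I, map_add,
      map_neg, Complex.conj_conj]
    have e : -ω + -Complex.I * h = -(ω + Complex.I * h) := by ring
    rw [e, div_neg]
    ring
  have hSf := hf.isSpectralMeasure hh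
  have hSg := hg.isSpectralMeasure hh
  have := hSf.finite
  have := hSg.finite
  have hhardy : hardyNorm h' φ ≤ 1 := by
    refine iSup₂_le fun y hy => ?_
    have hy : -h' < y := hy
    rw [eLpNorm_two_le_iff]
    have hb := lintegral_spectralIntegral_sub_sq_le hSf.support hSg.support hd
      (show h - h' ≤ y + h by linarith)
    have hval : ∀ x : ℝ, ‖φ (x + Complex.I * y)‖ₑ ^ 2 = ENNReal.ofReal (c / M) ^ 2 *
        ‖(spectralIntegral (spectralMeasure h f) (x + Complex.I * (y + h : ℝ)) -
          spectralIntegral (spectralMeasure h g) (x + Complex.I * (y + h : ℝ))) /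
          (x + Complex.I * (y + h : ℝ))‖ₑ ^ 2 := fun x => by
      have hm : (x : ℂ) + Complex.I * y ∈ halfPlane h := by
        simp [halfPlane]; linarith
      have e : (x : ℂ) + Complex.I * y + Complex.I * h = x + Complex.I * (y + h : ℝ) := by
        push_cast; ring
      rw [hnorm, mul_pow, hSf.repr _ hm, hSg.repr _ hm, e]
      rfl
    simp_rw [hval]
    rw [lintegral_const_mul' _ _ (by finiteness)]
    have hsum : starNorm (spectralMeasure h f) + starNorm (spectralMeasure h g)
        ≤ ENNReal.ofReal (2 * M) := by
      rw [two_mul, ENNReal.ofReal_add hM0.le hM0.le, ← hMe]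
      exact add_le_add (le_max_left _ _) (le_max_right _ _)
    calc _ ≤ ENNReal.ofReal (c / M) ^ 2 * (ENNReal.ofReal (2 * M) ^ 2 * ENNReal.ofReal K) := by
          gcongr
          refine hb.trans ?_
          gcongr
      _ = ENNReal.ofReal (c ^ 2 * (4 * K)) := by
          rw [← ENNReal.ofReal_pow (by positivity), ← ENNReal.ofReal_pow (by positivity),
            ← ENNReal.ofReal_mul (by positivity), ← ENNReal.ofReal_mul (by positivity)]
          congr 1
          field_simp
          ring
      _ ≤ 1 ^ 2 := by
          rw [one_pow, ← ENNReal.ofReal_one]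
          exact ENNReal.ofReal_le_ofReal hcK
  have hl2 : l2Norm (-1) 1 φ ≤ ENNReal.ofReal ε := by
    have hev : ∀ x : ℝ, ‖φ (-x)‖ = ‖φ x‖ := fun x => by
      have := hsymm (x : ℂ) (by simpa [halfPlane] using hh')
      rw [← this, Complex.norm_conj, Complex.conj_ofReal]
    rw [← ENNReal.pow_le_pow_left_iff two_ne_zero]
    refine (l2Norm_symm_sq_le hev).trans ?_
    rw [l2Norm, eLpNorm_two_sq]
    have hpt : ∀ x : ℝ, ‖φ x‖ₑ ^ 2 ≤ ENNReal.ofReal (c / (M * h)) ^ 2 * ‖f x - g x‖ₑ ^ 2 := by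
      intro x
      rw [hnorm, ← mul_pow]
      gcongr ?_ ^ 2
      rw [← ofReal_norm, ← ofReal_norm, ← ENNReal.ofReal_mul (by positivity),
        ← ENNReal.ofReal_mul (by positivity)]
      refine ENNReal.ofReal_le_ofReal ?_
      have hx : h ≤ ‖(x : ℂ) + Complex.I * h‖ := by
        refine le_trans ?_ (Complex.abs_im_le_norm _)
        simp [le_abs_self]
      rw [norm_div]
      calc c / M * (‖f x - g x‖ / ‖(x : ℂ) + Complex.I * h‖)
          ≤ c / M * (‖f x - g x‖ / h) := by gcongr
        _ = _ := by field_simp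
    have hle : l2Norm 0 1 (f - g) ≤ ENNReal.ofReal ε * ENNReal.ofReal M :=
      (ENNReal.div_le_iff (by simpa using hM0) (by simp)).1 hε
    calc 2 * ∫⁻ x in Ioo (0 : ℝ) 1, ‖φ x‖ₑ ^ 2
        ≤ 2 * ∫⁻ x in Ioo (0 : ℝ) 1, ENNReal.ofReal (c / (M * h)) ^ 2 * ‖f x - g x‖ₑ ^ 2 := by
          gcongr with x; exact hpt x
      _ = 2 * (ENNReal.ofReal (c / (M * h)) ^ 2 * l2Norm 0 1 (f - g) ^ 2) := by
          rw [lintegral_const_mul' _ _ (by finiteness), l2Norm, eLpNorm_two_sq]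
          rfl
      _ ≤ 2 * (ENNReal.ofReal (c / (M * h)) ^ 2 * (ENNReal.ofReal ε * ENNReal.ofReal M) ^ 2) := by
          gcongr
      _ = ENNReal.ofReal (c ^ 2 * (2 / h ^ 2)) * ENNReal.ofReal ε ^ 2 := by
          have h2 : (2 : ℝ≥0∞) = ENNReal.ofReal 2 := by simp
          rw [mul_pow, mul_comm (ENNReal.ofReal ε ^ 2), ← mul_assoc, ← mul_assoc, h2,
            ← ENNReal.ofReal_pow (by positivity), ← ENNReal.ofReal_pow (by positivity),
            ← ENNReal.ofReal_mul (by positivity), ← ENNReal.ofReal_mul (by positivity)]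
          congr 2
          field_simp
      _ ≤ 1 * ENNReal.ofReal ε ^ 2 := by
          gcongr
          rw [← ENNReal.ofReal_one]
          exact ENNReal.ofReal_le_ofReal hch
      _ = _ := one_mul _
  have hadm : φ ∈ admissible h' ε :=
    ⟨⟨hdiff, hhardy.trans_lt ENNReal.one_lt_top⟩, hsymm, hhardy, hl2⟩
  have hfin : ‖φ ω₀‖ₑ ≤ hardyError ω₀ h' ε := le_iSup₂ (f := fun f _ => ‖f (ω₀ : ℂ)‖ₑ) φ hadm
  calc ‖f ω₀ - g ω₀‖ₑ / ENNReal.ofReal M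
      = ENNReal.ofReal (‖(ω₀ : ℂ) + Complex.I * h‖ / c) * ‖φ ω₀‖ₑ := by
        rw [hnorm, ← ofReal_norm, ← ofReal_norm, ← ENNReal.ofReal_div_of_pos hM0,
          ← ENNReal.ofReal_mul (by positivity), ← ENNReal.ofReal_mul (by positivity), norm_div]
        congr 1
        field_simp
    _ ≤ _ := by
        rw [ENNReal.ofReal]
        gcongr

/-! ### Interior bounds in the Hardy class -/

theorem enorm_mul_le_lintegral_circle {g : ℂ → ℂ} {c : ℂ} {ρ s : ℝ}
    (hg : DifferentiableOn ℂ g (Metric.ball c ρ)) (hs : 0 < s) (hsρ : s < ρ) :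
    ‖g c‖ₑ * ENNReal.ofReal (2 * Real.pi)
      ≤ ∫⁻ θ in Ioo (-Real.pi) Real.pi, ‖g (circleMap c s θ)‖ₑ := by
  have hcl : DiffContOnCl ℂ g (Metric.ball c |s|) := by
    rw [abs_of_pos hs]
    refine DifferentiableOn.diffContOnCl (hg.mono ?_)
    exact Metric.closure_ball_subset_closedBall.trans (Metric.closedBall_subset_ball hsρ)
  have h1 := hcl.circleAverage
  have h2pi : 0 < 2 * Real.pi := Real.two_pi_pos
  rw [Real.circleAverage_eq_integral_add (-Real.pi),
    intervalIntegral.integral_comp_add_right (fun θ => g (circleMap c s θ)), zero_add,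
    show 2 * Real.pi + -Real.pi = Real.pi by ring,
    intervalIntegral.integral_of_le (by linarith [Real.pi_pos]), integral_Ioc_eq_integral_Ioo] at h1
  rw [← h1, enorm_smul, ← ofReal_norm, norm_inv, Real.norm_of_nonneg h2pi.le, mul_right_comm,
    ← ENNReal.ofReal_mul (by positivity), inv_mul_cancel₀ h2pi.ne', ENNReal.ofReal_one, one_mul]
  exact enorm_integral_le_lintegral_enorm _

/-- The mean value inequality over a disc, from the circles by polar coordinates. -/
theorem enorm_mul_le_lintegral_ball {g : ℂ → ℂ} {c : ℂ} {ρ : ℝ} (hρ : 0 < ρ)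
    (hg : DifferentiableOn ℂ g (Metric.ball c ρ)) :
    ‖g c‖ₑ * ENNReal.ofReal (Real.pi * ρ ^ 2) ≤ ∫⁻ z in Metric.ball c ρ, ‖g z‖ₑ := by
  classical
  let G : ℂ → ℝ≥0∞ := (Metric.ball c ρ).piecewise (fun z => ‖g z‖ₑ) 0
  have hGm : Measurable G := by
    refine ContinuousOn.measurable_piecewise ?_ continuous_zero.continuousOn measurableSet_ball
    exact hg.continuousOn.enorm
  have hpm : Measurable fun p : ℝ × ℝ => circleMap c p.1 p.2 := by
    simp only [circleMap]; fun_prop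
  have hsymm : ∀ p : ℝ × ℝ, c + Complex.polarCoord.symm p = circleMap c p.1 p.2 := fun p => by
    rw [Complex.polarCoord_symm_apply, circleMap, Complex.exp_mul_I]
    simp
  calc ‖g c‖ₑ * ENNReal.ofReal (Real.pi * ρ ^ 2)
      = ∫⁻ s in Ioo (0 : ℝ) ρ, ENNReal.ofReal s * (‖g c‖ₑ * ENNReal.ofReal (2 * Real.pi)) := by
        rw [lintegral_mul_const' _ _ (by finiteness), ← ofReal_integral_eq_lintegral_ofReal,
          ← integral_Ioc_eq_integral_Ioo, ← intervalIntegral.integral_of_le hρ.le, integral_id,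
          mul_left_comm, ← ENNReal.ofReal_mul (by rw [zero_pow two_ne_zero, sub_zero]; positivity)]
        · congr 2; ring
        · exact (continuous_id.integrableOn_Icc).mono_set Ioo_subset_Icc_self
        · filter_upwards [ae_restrict_mem measurableSet_Ioo] with s hs using hs.1.le
    _ ≤ ∫⁻ s in Ioo (0 : ℝ) ρ, ∫⁻ θ in Ioo (-Real.pi) Real.pi,
          ENNReal.ofReal s * G (circleMap c s θ) := by
        refine setLIntegral_mono' measurableSet_Ioo fun s hs => ?_
        rw [lintegral_const_mul' _ _ (by finiteness)]
        gcongr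
        refine (enorm_mul_le_lintegral_circle hg hs.1 hs.2).trans (lintegral_mono fun θ => ?_)
        have hmem : circleMap c s θ ∈ Metric.ball c ρ := by
          rw [mem_ball_iff_norm, circleMap_sub_center, norm_circleMap_zero, abs_of_pos hs.1]
          exact hs.2
        exact (piecewise_eq_of_mem (Metric.ball c ρ) (fun z => ‖g z‖ₑ) 0 hmem).ge
    _ ≤ ∫⁻ s in Ioi (0 : ℝ), ∫⁻ θ in Ioo (-Real.pi) Real.pi,
          ENNReal.ofReal s * G (circleMap c s θ) := lintegral_mono_set Ioo_subset_Ioi_self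
    _ = ∫⁻ p in polarCoord.target, ENNReal.ofReal p.1 • G (c + Complex.polarCoord.symm p) := by
        have : polarCoord.target = Ioi (0 : ℝ) ×ˢ Ioo (-Real.pi) Real.pi := rfl
        rw [this, Measure.volume_eq_prod, ← Measure.prod_restrict, lintegral_prod]
        · simp_rw [hsymm, smul_eq_mul]
        · simp_rw [hsymm, smul_eq_mul]
          exact (Measurable.mul (by fun_prop) (hGm.comp hpm)).aemeasurable
    _ = ∫⁻ z, G (c + z) := Complex.lintegral_comp_polarCoord_symm fun z => G (c + z)
    _ = ∫⁻ z, G z := lintegral_add_left_eq_self G c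
    _ = ∫⁻ z in Metric.ball c ρ, ‖g z‖ₑ := by
        rw [← lintegral_indicator measurableSet_ball]
        refine lintegral_congr fun z => ?_
        simp only [G, piecewise, indicator]
        rfl

theorem lintegral_line_le_of_hardyNorm_le {h : ℝ} {φ : ℂ → ℂ} (hφ : hardyNorm h φ ≤ 1) {y : ℝ}
    (hy : -h < y) : ∫⁻ x : ℝ, ‖φ ((x : ℂ) + Complex.I * y)‖ₑ ^ 2 ≤ 1 := by
  have h1 : eLpNorm (fun x : ℝ => φ ((x : ℂ) + Complex.I * (y : ℂ))) 2 volume ≤ 1 :=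
    (le_iSup₂ (f := fun (y : ℝ) (_ : y ∈ Ioi (-h)) =>
      eLpNorm (fun x : ℝ => φ ((x : ℂ) + Complex.I * (y : ℂ))) 2 volume)
      y (show y ∈ Ioi (-h) from hy)).trans hφ
  simpa using eLpNorm_two_le_iff.1 h1

/-- Functions in the Hardy class are bounded on smaller half-planes: apply the area mean value
inequality to `φ²`. -/
theorem exists_bound_of_hardyNorm_le {h : ℝ} {φ : ℂ → ℂ} (hd : DifferentiableOn ℂ φ (halfPlane h))
    (hφ : hardyNorm h φ ≤ 1) {r : ℝ} (hr : 0 < r) :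
    ∃ B : ℝ, 0 ≤ B ∧ ∀ w : ℂ, r - h ≤ w.im → ‖φ w‖ ≤ B := by
  classical
  refine ⟨√(2 / (Real.pi * r)), by positivity, fun w hw => ?_⟩
  have him : ∀ z ∈ Metric.ball w r, |z.im - w.im| < r := fun z hz => by
    rw [mem_ball_iff_norm] at hz
    rw [← Complex.sub_im]
    exact (Complex.abs_im_le_norm _).trans_lt hz
  have hsub : Metric.ball w r ⊆ halfPlane h := fun z hz => by
    have := (abs_lt.1 (him z hz)).1
    change -h < z.im
    linarith
  have h1 := enorm_mul_le_lintegral_ball hr ((hd.mono hsub).pow 2)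
  let G : ℂ → ℝ≥0∞ := (Metric.ball w r).piecewise (fun z => ‖φ z‖ₑ ^ 2) 0
  have hGm : Measurable G := by
    refine ContinuousOn.measurable_piecewise ?_ continuous_zero.continuousOn measurableSet_ball
    exact (ENNReal.continuous_pow 2).comp_continuousOn (hd.mono hsub).continuousOn.enorm
  have h2 : ∫⁻ z in Metric.ball w r, ‖φ z ^ 2‖ₑ ≤ ENNReal.ofReal (2 * r) := by
    calc ∫⁻ z in Metric.ball w r, ‖φ z ^ 2‖ₑ = ∫⁻ z, G z := by
          rw [← lintegral_indicator measurableSet_ball]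
          refine lintegral_congr fun z => ?_
          simp only [G, piecewise, indicator, enorm_pow]
          rfl
      _ = ∫⁻ p : ℝ × ℝ, G (Complex.measurableEquivRealProd.symm p) :=
          ((Complex.volume_preserving_equiv_real_prod.symm).lintegral_comp hGm).symm
      _ = ∫⁻ y : ℝ, ∫⁻ x : ℝ, G (Complex.measurableEquivRealProd.symm (x, y)) := by
          rw [Measure.volume_eq_prod, lintegral_prod_symm]
          exact (hGm.comp (MeasurableEquiv.measurable _)).aemeasurable
      _ ≤ ∫⁻ y : ℝ, (Ioo (w.im - r) (w.im + r)).indicator 1 y := by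
          refine lintegral_mono fun y => ?_
          have hz : ∀ x : ℝ, Complex.measurableEquivRealProd.symm (x, y) = x + Complex.I * y :=
            fun x => by apply Complex.ext <;> simp [Complex.measurableEquivRealProd]
          simp_rw [hz]
          by_cases hy : y ∈ Ioo (w.im - r) (w.im + r)
          · rw [indicator_of_mem hy]
            refine le_trans (lintegral_mono fun x => ?_)
              (lintegral_line_le_of_hardyNorm_le hφ (y := y) (by linarith [hy.1]))
            simp only [G, piecewise]
            split_ifs
            · exact le_rfl
            · exact zero_le
          · rw [indicator_of_notMem hy]
            have : ∀ x : ℝ, G (x + Complex.I * y) = 0 := fun x => by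
              refine piecewise_eq_of_notMem _ _ _ fun hmem => hy ?_
              have := abs_lt.1 (him _ hmem)
              simp at this
              exact ⟨by linarith, by linarith⟩
            simp [this]
      _ = ENNReal.ofReal (2 * r) := by
          rw [lintegral_indicator_one measurableSet_Ioo, Real.volume_Ioo]
          congr 1; ring
  have h3 := h1.trans h2
  rw [Pi.pow_apply, enorm_pow, ← ofReal_norm, ← ENNReal.ofReal_pow (norm_nonneg _),
    ← ENNReal.ofReal_mul (by positivity), ENNReal.ofReal_le_ofReal_iff (by positivity)] at h3
  refine Real.le_sqrt_of_sq_le ?_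
  rw [le_div_iff₀ (by have := Real.pi_pos; positivity)]
  have h4 : (‖φ w‖ ^ 2 * (Real.pi * r)) * r ≤ 2 * r := by linarith
  exact le_of_mul_le_mul_right h4 hr

/-- The norm on the interval depends continuously on a small vertical shift. -/
theorem tendsto_l2Norm_shift {h : ℝ} (hh : 0 < h) {φ : ℂ → ℂ}
    (hd : DifferentiableOn ℂ φ (halfPlane h)) (hφ : hardyNorm h φ ≤ 1) :
    Tendsto (fun δ : ℝ => ∫⁻ x in Ioo (-1 : ℝ) 1, ‖φ ((x : ℂ) + Complex.I * δ)‖ₑ ^ 2) (𝓝[>] 0)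
      (𝓝 (∫⁻ x in Ioo (-1 : ℝ) 1, ‖φ (x : ℂ)‖ₑ ^ 2)) := by
  obtain ⟨B, hB0, hB⟩ := exists_bound_of_hardyNorm_le hd hφ hh
  have hmem : ∀ (x : ℝ) {δ : ℝ}, 0 ≤ δ → (x : ℂ) + Complex.I * δ ∈ halfPlane h := fun x δ hδ => by
    simp [halfPlane]; linarith
  have hop : IsOpen (halfPlane h) := isOpen_lt continuous_const Complex.continuous_im
  refine tendsto_lintegral_filter_of_dominated_convergence (fun _ => ENNReal.ofReal B ^ 2)
    ?_ ?_ ?_ ?_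
  · filter_upwards [self_mem_nhdsWithin] with δ (hδ : 0 < δ)
    have : Continuous fun x : ℝ => φ ((x : ℂ) + Complex.I * δ) :=
      hd.continuousOn.comp_continuous (by fun_prop) fun x => hmem x hδ.le
    exact (this.measurable.enorm).pow_const 2
  · filter_upwards [self_mem_nhdsWithin] with δ (hδ : 0 < δ)
    refine ae_of_all _ fun x => ?_
    gcongr
    rw [← ofReal_norm]
    exact ENNReal.ofReal_le_ofReal (hB _ (by simpa using hδ.le))
  · rw [lintegral_const]
    simp only [Measure.restrict_apply_univ, Real.volume_Ioo]
    finiteness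
  · refine ae_of_all _ fun x => ?_
    have hc : ContinuousAt φ (x : ℂ) := hd.continuousOn.continuousAt
      (hop.mem_nhds (by simpa using hmem x le_rfl))
    refine ((ENNReal.continuous_pow 2).tendsto _).comp ?_
    refine (continuous_enorm.tendsto _).comp (hc.tendsto.comp ?_)
    have : Tendsto (fun δ : ℝ => (x : ℂ) + Complex.I * δ) (𝓝 0) (𝓝 (x + Complex.I * (0 : ℝ))) :=
      Continuous.tendsto (by fun_prop) 0
    simpa using this.mono_left nhdsWithin_le_nhds

/-! ### Splitting a Hardy function into two transforms -/

theorem spectralIntegral_add {σ τ : Measure ℝ} [IsFiniteMeasure σ] [IsFiniteMeasure τ]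
    (hσ : σ (Iio 0) = 0) (hτ : τ (Iio 0) = 0) {ζ : ℂ} (hζ : 0 < ζ.im) :
    spectralIntegral (σ + τ) ζ = spectralIntegral σ ζ + spectralIntegral τ ζ :=
  integral_add_measure (integrable_kernel hσ hζ) (integrable_kernel hτ hζ)

/-- The positive and the negative part of the boundary imaginary part give the splitting. -/
theorem eq_sub_spectralIntegral_quadMeasure {ψ : ℂ → ℂ} {C : ℝ}
    (hψ : DifferentiableOn ℂ ψ {w | 0 ≤ w.im})
    (hb : ∀ w : ℂ, 0 ≤ w.im → ‖ψ w‖ ≤ C / (1 + ‖w‖ ^ 2))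
    (hsymm : ∀ x : ℝ, ψ (-x) = conj (ψ x)) {ζ : ℂ} (hζ : 0 < ζ.im) :
    ψ ζ = spectralIntegral (quadMeasure fun x => max (ψ x).im 0) ζ
      - spectralIntegral (quadMeasure fun x => max (-(ψ x).im) 0) ζ := by
  have hc : Continuous fun x : ℝ => (ψ x).im :=
    Complex.continuous_im.comp (continuous_ofReal_of_differentiableOn hψ)
  have hm1 : Measurable fun x : ℝ => max (ψ x).im 0 := by
    have := hc.measurable; fun_prop
  have hm2 : Measurable fun x : ℝ => max (-(ψ x).im) 0 := by
    have := hc.measurable; fun_prop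
  obtain ⟨hint, heq⟩ := eq_integral_im hψ hb hsymm hζ
  have hdom : ∀ q : ℝ → ℝ, Measurable q → (∀ x : ℝ, |q x| ≤ |(ψ x).im|) →
      IntegrableOn (fun x : ℝ => ((2 / Real.pi * (x * q x) : ℝ) : ℂ) *
        (((x ^ 2 : ℝ) : ℂ) - ζ ^ 2)⁻¹) (Ioi 0) := fun q hq hle => by
    refine Integrable.mono hint (Measurable.aestronglyMeasurable (by fun_prop))
      (ae_of_all _ fun x => ?_)
    rw [norm_mul, norm_mul, Complex.norm_real, Complex.norm_real, norm_mul, norm_mul, norm_mul,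
      norm_mul, Real.norm_eq_abs (q x), Real.norm_eq_abs (ψ x).im]
    have hx := hle x
    generalize |q x| = a at hx ⊢
    gcongr
  rw [spectralIntegral, spectralIntegral,
    integral_quadMeasure hm1 (fun x _ => le_max_right _ _) (measurable_kernel ζ),
    integral_quadMeasure hm2 (fun x _ => le_max_right _ _) (measurable_kernel ζ),
    ← integral_sub (hdom _ hm1 fun x => ?_) (hdom _ hm2 fun x => ?_), heq]
  · refine integral_congr_ae (ae_of_all _ fun x => ?_)
    simp only
    rw [← sub_mul, ← Complex.ofReal_sub]
    congr 2
    have : (ψ x).im = max (ψ x).im 0 - max (-(ψ x).im) 0 := by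
      rcases le_total 0 (ψ x).im with h | h
      · rw [max_eq_left h, max_eq_right (by linarith), sub_zero]
      · rw [max_eq_right h, max_eq_left (by linarith)]; ring
    rw [← mul_sub, ← mul_sub, ← this]
  · rcases le_total 0 (ψ x).im with h | h
    · rw [max_eq_left h]
    · rw [max_eq_right h, abs_zero]; positivity
  · rcases le_total 0 (ψ x).im with h | h
    · rw [max_eq_right (by linarith), abs_zero]; positivity
    · rw [max_eq_left (by linarith), abs_neg]

/-- Sixth-order decay of the density makes the measure and its first moment finite. -/
theorem lintegral_quadMeasure_moment_lt_top {p : ℝ → ℝ} (hp : Measurable p)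
    {B : ℝ} (hpB : ∀ x, 0 < x → p x ≤ B / (1 + x ^ 2) ^ 3) (hB : 0 ≤ B) :
    ∫⁻ t, ENNReal.ofReal (1 + t) ∂quadMeasure p < ∞ := by
  rw [lintegral_quadMeasure hp (by fun_prop)]
  have hint : Integrable fun x : ℝ => B * (1 + x ^ 2)⁻¹ := integrable_inv_one_add_sq.const_mul B
  refine lt_of_le_of_lt ?_ (hint.integrableOn (s := Ioi (0 : ℝ))).lintegral_lt_top
  refine setLIntegral_mono' measurableSet_Ioi fun x (hx : 0 < x) => ?_
  rw [← ENNReal.ofReal_mul' (by positivity)]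
  refine ENNReal.ofReal_le_ofReal ?_
  have hpi : 2 / Real.pi ≤ 1 := by
    rw [div_le_one Real.pi_pos]; exact Real.two_le_pi
  have h1 : x ≤ 1 + x ^ 2 := by nlinarith [sq_nonneg (x - 1)]
  calc 2 / Real.pi * (x * p x) * (1 + x ^ 2)
      ≤ 2 / Real.pi * (x * (B / (1 + x ^ 2) ^ 3)) * (1 + x ^ 2) := by
        have := hpB x hx
        have := Real.pi_pos
        gcongr
    _ ≤ 1 * ((1 + x ^ 2) * (B / (1 + x ^ 2) ^ 3)) * (1 + x ^ 2) := by gcongr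
    _ = B * (1 + x ^ 2)⁻¹ := by field_simp

theorem isFiniteMeasure_quadMeasure {p : ℝ → ℝ} (hp : Measurable p)
    {B : ℝ} (hpB : ∀ x, 0 < x → p x ≤ B / (1 + x ^ 2) ^ 3) (hB : 0 ≤ B) :
    IsFiniteMeasure (quadMeasure p) := by
  refine ⟨lt_of_le_of_lt ?_ (lintegral_quadMeasure_moment_lt_top hp hpB hB)⟩
  rw [← lintegral_one]
  refine lintegral_mono_ae ((ae_nonneg_of_support (quadMeasure_Iio p)).mono fun t ht => ?_)
  rw [← ENNReal.ofReal_one]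
  exact ENNReal.ofReal_le_ofReal (by linarith)

theorem integrable_id_quadMeasure {p : ℝ → ℝ} (hp : Measurable p)
    {B : ℝ} (hpB : ∀ x, 0 < x → p x ≤ B / (1 + x ^ 2) ^ 3) (hB : 0 ≤ B) :
    Integrable (fun t : ℝ => t) (quadMeasure p) := by
  refine ⟨measurable_id.aestronglyMeasurable,
    lt_of_le_of_lt ?_ (lintegral_quadMeasure_moment_lt_top hp hpB hB)⟩
  refine lintegral_mono_ae ((ae_nonneg_of_support (quadMeasure_Iio p)).mono fun t ht => ?_)
  rw [← ofReal_norm, Real.norm_of_nonneg ht]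
  exact ENNReal.ofReal_le_ofReal (by linarith)

theorem spectralIntegral_I_mul (σ : Measure ℝ) (y : ℝ) :
    spectralIntegral σ (Complex.I * y) = ((∫ t, (t + y ^ 2)⁻¹ ∂σ : ℝ) : ℂ) := by
  rw [spectralIntegral, ← integral_complex_ofReal]
  refine integral_congr_ae (ae_of_all _ fun t => ?_)
  simp only
  rw [mul_pow, Complex.I_sq]
  push_cast
  ring

theorem spectralIntegral_I_mul_re_nonneg {σ : Measure ℝ} (hs : σ (Iio 0) = 0) (y : ℝ) :
    0 ≤ (spectralIntegral σ (Complex.I * y)).re := by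
  rw [spectralIntegral_I_mul, Complex.ofReal_re]
  refine integral_nonneg_of_ae ((ae_nonneg_of_support hs).mono fun t ht => ?_)
  simp only [Pi.zero_apply]
  positivity

/-- The weighted mass of a density dominated by an `L²` function of norm at most `1` is at most an
absolute constant; `3` bounds `(1 + π) / 2`. -/
theorem spectralIntegral_quadMeasure_re_le {p : ℝ → ℝ} (hp : Measurable p) {q : ℝ → ℂ}
    (hpq : ∀ x, 0 < x → p x ≤ ‖q x‖) (hq : ∫⁻ x, ‖q x‖ₑ ^ 2 ≤ 1) {y : ℝ} (hy : 1 ≤ y) :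
    (spectralIntegral (quadMeasure p) (Complex.I * y)).re ≤ 3 := by
  have hae := ae_nonneg_of_support (quadMeasure_Iio p)
  rw [spectralIntegral_I_mul, Complex.ofReal_re, integral_eq_lintegral_of_nonneg_ae
    (hae.mono fun t ht => by simp only [Pi.zero_apply]; positivity)
    (Measurable.aestronglyMeasurable (by fun_prop))]
  refine ENNReal.toReal_le_of_le_ofReal (by norm_num) ?_
  rw [lintegral_quadMeasure hp (by fun_prop)]
  have hlor : ∫⁻ x : ℝ, ENNReal.ofReal ((1 + x ^ 2)⁻¹) ≤ ENNReal.ofReal 4 := by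
    rw [← ofReal_integral_eq_lintegral_ofReal integrable_inv_one_add_sq
      (ae_of_all _ fun x => by simp only [Pi.zero_apply]; positivity), integral_univ_inv_one_add_sq]
    exact ENNReal.ofReal_le_ofReal Real.pi_le_four
  calc ∫⁻ x in Ioi (0 : ℝ), ENNReal.ofReal (2 / Real.pi * (x * p x)) *
        ENNReal.ofReal ((x ^ 2 + y ^ 2)⁻¹)
      ≤ ∫⁻ x in Ioi (0 : ℝ), ENNReal.ofReal (1 / 2) *
          (‖q x‖ₑ ^ 2 + ENNReal.ofReal ((1 + x ^ 2)⁻¹)) := by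
        refine setLIntegral_mono' measurableSet_Ioi fun x (hx : 0 < x) => ?_
        rw [← ofReal_norm, ← ENNReal.ofReal_pow (by positivity),
          ← ENNReal.ofReal_add (by positivity) (by positivity),
          ← ENNReal.ofReal_mul' (by positivity), ← ENNReal.ofReal_mul (by norm_num)]
        refine ENNReal.ofReal_le_ofReal ?_
        have hpi : 2 / Real.pi ≤ 1 := by
          rw [div_le_one Real.pi_pos]; exact Real.two_le_pi
        have hx1 : (x * (1 + x ^ 2)⁻¹) ^ 2 ≤ (1 + x ^ 2)⁻¹ := by
          rw [mul_pow, inv_pow, sq (1 + x ^ 2), mul_inv, ← mul_assoc]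
          refine mul_le_of_le_one_left (by positivity) ?_
          rw [← div_eq_mul_inv, div_le_one (by positivity)]
          linarith
        have h2 := two_mul_le_add_sq ‖q x‖ (x * (1 + x ^ 2)⁻¹)
        have := Real.pi_pos
        calc 2 / Real.pi * (x * p x) * (x ^ 2 + y ^ 2)⁻¹
            ≤ 2 / Real.pi * (x * ‖q x‖) * (x ^ 2 + y ^ 2)⁻¹ := by gcongr; exact hpq x hx
          _ ≤ 1 * (x * ‖q x‖) * (1 + x ^ 2)⁻¹ := by
              gcongr ?_ * _ * ?_⁻¹
              nlinarith
          _ ≤ 1 / 2 * (‖q x‖ ^ 2 + (1 + x ^ 2)⁻¹) := by nlinarith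
    _ ≤ ∫⁻ x : ℝ, ENNReal.ofReal (1 / 2) * (‖q x‖ₑ ^ 2 + ENNReal.ofReal ((1 + x ^ 2)⁻¹)) :=
        setLIntegral_le_lintegral _ _
    _ ≤ ENNReal.ofReal (1 / 2) * (1 + ENNReal.ofReal 4) := by
        rw [lintegral_const_mul' _ _ (by finiteness), lintegral_add_right _ (by fun_prop)]
        gcongr
    _ ≤ ENNReal.ofReal 3 := by
        rw [← ENNReal.ofReal_one, ← ENNReal.ofReal_add (by norm_num) (by norm_num),
          ← ENNReal.ofReal_mul (by norm_num)]
        exact ENNReal.ofReal_le_ofReal (by norm_num)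

/-- The multiplier `(i / (ζ + i))⁶`, compatible with the symmetry. The power `6` leaves enough
decay for the first moment of the resulting density in the variable `t = x²`. -/
def damping (ζ : ℂ) : ℂ := (Complex.I / (ζ + Complex.I)) ^ 6

theorem norm_damping (ζ : ℂ) : ‖damping ζ‖ = (‖ζ + Complex.I‖ ^ 6)⁻¹ := by
  simp [damping]

theorem norm_damping_le {ζ : ℂ} (hζ : 0 ≤ ζ.im) : ‖damping ζ‖ ≤ ((1 + ‖ζ‖ ^ 2) ^ 3)⁻¹ := by
  rw [norm_damping]
  have h : 1 + ‖ζ‖ ^ 2 ≤ ‖ζ + Complex.I‖ ^ 2 := by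
    rw [Complex.sq_norm, Complex.sq_norm, Complex.normSq_apply, Complex.normSq_apply]
    simp
    nlinarith
  have e : ‖ζ + Complex.I‖ ^ 6 = (‖ζ + Complex.I‖ ^ 2) ^ 3 := by ring
  rw [e]
  gcongr

theorem norm_damping_le_one {ζ : ℂ} (hζ : 0 ≤ ζ.im) : ‖damping ζ‖ ≤ 1 :=
  (norm_damping_le hζ).trans (inv_le_one_of_one_le₀ (one_le_pow₀ (by nlinarith [norm_nonneg ζ])))

theorem differentiableOn_damping : DifferentiableOn ℂ damping {w | 0 ≤ w.im} := by
  refine DifferentiableOn.pow (DifferentiableOn.div (by fun_prop) (by fun_prop) ?_) 6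
  intro w (hw : 0 ≤ w.im) h0
  have := congrArg Complex.im h0
  simp at this
  linarith

theorem damping_neg_conj (ζ : ℂ) : damping (-conj ζ) = conj (damping ζ) := by
  simp only [damping, map_pow, map_div₀, map_add, Complex.conj_I]
  congr 1
  rw [show -conj ζ + Complex.I = -(conj ζ + -Complex.I) by ring, div_neg, neg_div]

/-! ### Bounding the Hardy problem by the extrapolation error -/

/-- A damped shift of a symmetric function in the Hardy unit ball is a difference of two members
of `K_h` whose norms are bounded above and below by absolute constants. The measures sit on the
line `Im ω = -(h + δ/2)`, halfway between the line of `K_h` and the boundary of the domain of the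
shift. A point mass at `0` keeps the norm of the pair away from zero. -/
theorem exists_classK_sub_eq {h δ : ℝ} (hh : 0 < h) (hδ : 0 < δ) (hδ2 : δ ≤ 2) {φ : ℂ → ℂ}
    (hd : DifferentiableOn ℂ φ (halfPlane h)) (hs : IsSymm h φ) (hφ : hardyNorm h φ ≤ 1) :
    ∃ f g : ℂ → ℂ, ClassK h f ∧ ClassK h g ∧
      (∀ ω ∈ halfPlane h, f ω - g ω = φ (ω + Complex.I * δ) *
        damping (ω + Complex.I * ((h + δ / 2 : ℝ) : ℂ))) ∧
      2 ≤ (f (normPoint h)).re ∧ (f (normPoint h)).re ≤ 11 ∧ (g (normPoint h)).re ≤ 11 := by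
  set H : ℝ := h + δ / 2 with hH
  have hhH : h < H := by linarith
  -- The damped shift in the variable `ζ = ω + i H`.
  let ψ : ℂ → ℂ := fun ζ => φ (ζ + Complex.I * ((δ - H : ℝ) : ℂ)) * damping ζ
  have him : ∀ ζ : ℂ, (ζ + Complex.I * ((δ - H : ℝ) : ℂ)).im = ζ.im + (δ / 2 - h) := fun ζ => by
    simp only [Complex.add_im, Complex.mul_im, Complex.I_re, Complex.I_im, Complex.ofReal_re,
      Complex.ofReal_im, hH]
    ring
  have hmem : ∀ ζ : ℂ, 0 ≤ ζ.im → ζ + Complex.I * ((δ - H : ℝ) : ℂ) ∈ halfPlane h := fun ζ hζ => by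
    change -h < _
    rw [him]; linarith
  obtain ⟨B, hB0, hB⟩ := exists_bound_of_hardyNorm_le hd hφ (show 0 < δ / 2 by positivity)
  have hB : ∀ ζ : ℂ, 0 ≤ ζ.im → ‖φ (ζ + Complex.I * ((δ - H : ℝ) : ℂ))‖ ≤ B := fun ζ hζ =>
    hB _ (by rw [him]; linarith)
  have hψd : DifferentiableOn ℂ ψ {w | 0 ≤ w.im} :=
    (hd.comp (by fun_prop) fun ζ hζ => hmem ζ hζ).mul differentiableOn_damping
  have hψb3 : ∀ w : ℂ, 0 ≤ w.im → ‖ψ w‖ ≤ B / (1 + ‖w‖ ^ 2) ^ 3 := fun w hw => by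
    rw [norm_mul, div_eq_mul_inv]
    gcongr
    · exact hB w hw
    · exact norm_damping_le hw
  have hψb : ∀ w : ℂ, 0 ≤ w.im → ‖ψ w‖ ≤ B / (1 + ‖w‖ ^ 2) := fun w hw => by
    refine (hψb3 w hw).trans ?_
    gcongr
    exact le_self_pow₀ (by nlinarith [norm_nonneg w]) (by norm_num)
  have hψs : ∀ x : ℝ, ψ (-x) = conj (ψ x) := fun x => by
    have h1 := hs _ (hmem (-x : ℝ) (by simp))
    simp only [ψ, map_mul]
    rw [← damping_neg_conj, Complex.conj_ofReal, ← Complex.ofReal_neg, ← h1]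
    simp [add_comm]
  have hcont : Continuous fun x : ℝ => (ψ x).im :=
    Complex.continuous_im.comp (continuous_ofReal_of_differentiableOn hψd)
  have hrep : ∀ p : ℝ → ℝ, Measurable p → (∀ x : ℝ, p x ≤ ‖ψ x‖) →
      ClassK h (fun ω => spectralIntegral ((8 : ℝ≥0) • Measure.dirac 0 + quadMeasure p)
        (ω + Complex.I * H)) ∧
      (∀ ζ : ℂ, 0 < ζ.im → spectralIntegral ((8 : ℝ≥0) • Measure.dirac 0 + quadMeasure p) ζ
        = spectralIntegral ((8 : ℝ≥0) • Measure.dirac 0) ζ + spectralIntegral (quadMeasure p) ζ) ∧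
      2 ≤ (spectralIntegral ((8 : ℝ≥0) • Measure.dirac 0 + quadMeasure p)
        (normPoint h + Complex.I * H)).re ∧
      (spectralIntegral ((8 : ℝ≥0) • Measure.dirac 0 + quadMeasure p)
        (normPoint h + Complex.I * H)).re ≤ 11 := by
    intro p hp hple
    have hpB : ∀ x : ℝ, 0 < x → p x ≤ B / (1 + x ^ 2) ^ 3 := fun x _ =>
      (hple x).trans (by simpa using hψb3 x (by simp))
    have hfin := isFiniteMeasure_quadMeasure hp hpB hB0
    have hmom := integrable_id_quadMeasure hp hpB hB0
    have hd0 : ((8 : ℝ≥0) • Measure.dirac (0 : ℝ)) (Iio 0) = 0 := by simp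
    have hdf : IsFiniteMeasure ((8 : ℝ≥0) • Measure.dirac (0 : ℝ)) := inferInstance
    have hq0 := quadMeasure_Iio p
    have hadd : ∀ ζ : ℂ, 0 < ζ.im → spectralIntegral ((8 : ℝ≥0) • Measure.dirac 0 + quadMeasure p) ζ
        = spectralIntegral ((8 : ℝ≥0) • Measure.dirac 0) ζ + spectralIntegral (quadMeasure p) ζ :=
      fun ζ hζ => spectralIntegral_add hd0 hq0 hζ
    have hval : (spectralIntegral ((8 : ℝ≥0) • Measure.dirac 0 + quadMeasure p)
        (normPoint h + Complex.I * H)).re = 8 / (1 + δ / 2) ^ 2 +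
        (spectralIntegral (quadMeasure p) (Complex.I * (1 + δ / 2 : ℝ))).re := by
      have e : normPoint h + Complex.I * H = Complex.I * (1 + δ / 2 : ℝ) := by
        rw [normPoint, ← mul_add, ← Complex.ofReal_add, hH]
        congr 2; ring
      rw [e, hadd _ (by simp; positivity), Complex.add_re, spectralIntegral_I_mul,
        Complex.ofReal_re]
      simp [integral_smul_nnreal_measure, NNReal.smul_def, div_eq_mul_inv]
    refine ⟨classK_spectralIntegral ?_ ?_ ?_ hh hhH, hadd, ?_, ?_⟩
    · simp [hq0]
    · intro h0
      have := congrArg (fun μ : Measure ℝ => μ univ) h0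
      simp at this
    · refine Integrable.add_measure ?_ hmom
      exact Integrable.smul_measure_nnreal (integrable_dirac (by simp))
    · rw [hval]
      have h1 := spectralIntegral_I_mul_re_nonneg hq0 (1 + δ / 2)
      have h2 : 2 ≤ 8 / (1 + δ / 2) ^ 2 := by
        rw [le_div_iff₀ (by positivity)]
        nlinarith
      linarith
    · rw [hval]
      have h1 := spectralIntegral_quadMeasure_re_le hp
        (q := fun x : ℝ => φ (x + Complex.I * ((δ - H : ℝ) : ℂ))) (fun x _ => ?_)
        (lintegral_line_le_of_hardyNorm_le hφ (by linarith)) (y := 1 + δ / 2) (by linarith)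
      · have h2 : 8 / (1 + δ / 2) ^ 2 ≤ 8 := by
          rw [div_le_iff₀ (by positivity)]
          nlinarith
        linarith
      · refine (hple x).trans ?_
        rw [norm_mul]
        exact mul_le_of_le_one_right (norm_nonneg _) (norm_damping_le_one (by simp))
  have hle := fun x : ℝ => Complex.abs_im_le_norm (ψ x)
  obtain ⟨hf, hfa, hf2, hf11⟩ := hrep (fun x => max (ψ x).im 0)
    (hcont.max continuous_const).measurable
    (fun x => max_le ((le_abs_self _).trans (hle x)) (norm_nonneg _))
  obtain ⟨hg, hga, -, hg11⟩ := hrep (fun x => max (-(ψ x).im) 0)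
    (hcont.neg.max continuous_const).measurable
    (fun x => max_le ((neg_le_abs _).trans (hle x)) (norm_nonneg _))
  refine ⟨_, _, hf, hg, fun ω hω => ?_, hf2, hf11, hg11⟩
  have hω' : -h < ω.im := hω
  have hζ : 0 < (ω + Complex.I * H).im := by simp; linarith
  have h1 := eq_sub_spectralIntegral_quadMeasure hψd hψb hψs hζ
  have e : ω + Complex.I * H + Complex.I * ((δ - H : ℝ) : ℂ) = ω + Complex.I * δ := by
    push_cast; ring
  simp only [ψ, e] at h1
  rw [hfa _ hζ, hga _ hζ, h1]
  ring

/-- The shift `φ(· + iδ)` of an admissible function has norm at most `2ε` on the interval once `δ`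
is small, and `exists_classK_sub_eq` turns it into an admissible pair; then `δ → 0`. Shifting
avoids boundary values of Hardy functions. -/
theorem hardyError_le_worstError {h : ℝ} (hh : 0 < h) (ω₀ : ℝ) :
    ∃ C : ℝ≥0, 0 < C ∧ ∀ ε : ℝ, 0 < ε → hardyError ω₀ h ε ≤ C * worstError ω₀ h ε := by
  set c : ℝ := 11 * (|ω₀| + h + 2) ^ 6 with hc
  have hc0 : 0 < c := by positivity
  refine ⟨c.toNNReal, by simpa using hc0, fun ε hε => iSup₂_le fun φ hφ => ?_⟩
  obtain ⟨⟨hd, -⟩, hs, hφn, hl2⟩ := hφ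
  have hkey : ∀ᶠ δ : ℝ in 𝓝[>] 0,
      ‖φ (ω₀ + Complex.I * δ)‖ₑ ≤ ENNReal.ofReal c * worstError ω₀ h ε := by
    have hlim := tendsto_l2Norm_shift hh hd hφn
    have hlt : ∫⁻ x in Ioo (-1 : ℝ) 1, ‖φ (x : ℂ)‖ₑ ^ 2 < ENNReal.ofReal (2 * ε) ^ 2 := by
      refine (eLpNorm_two_le_iff.1 hl2).trans_lt ?_
      rw [ENNReal.pow_lt_pow_left_iff two_ne_zero]
      exact (ENNReal.ofReal_lt_ofReal_iff (by positivity)).2 (by linarith)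
    filter_upwards [hlim.eventually (eventually_lt_nhds hlt), self_mem_nhdsWithin,
      mem_nhdsWithin_of_mem_nhds (Iic_mem_nhds (show (0 : ℝ) < 2 by norm_num))]
      with δ hδl (hδ : 0 < δ) (hδ2 : δ ≤ 2)
    obtain ⟨f, g, hf, hg, hfg, hf2, hf11, hg11⟩ := exists_classK_sub_eq hh hδ hδ2 hd hs hφn
    have hreal : ∀ x : ℝ, (x : ℂ) ∈ halfPlane h := fun x => by simpa [halfPlane] using hh
    have hN : pairNorm h f g = max (ENNReal.ofReal (f (normPoint h)).re)
        (ENNReal.ofReal (g (normPoint h)).re) := by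
      rw [pairNorm, hf.starNorm_eq hh, hg.starNorm_eq hh]
    -- This lower bound absorbs the factor `2` lost in the norm on the interval.
    have hN2 : 2 ≤ pairNorm h f g := by
      rw [hN]
      refine le_max_of_le_left ?_
      have : (2 : ℝ≥0∞) = ENNReal.ofReal 2 := by simp
      rw [this]
      exact ENNReal.ofReal_le_ofReal hf2
    have hN11 : pairNorm h f g ≤ ENNReal.ofReal 11 := by
      rw [hN]
      exact max_le (ENNReal.ofReal_le_ofReal hf11) (ENNReal.ofReal_le_ofReal hg11)
    have hpair : (f, g) ∈ pairs h ε := by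
      refine ⟨hf, hg, ?_⟩
      have h1 : l2Norm 0 1 (f - g) ≤ ENNReal.ofReal (2 * ε) := by
        rw [l2Norm, eLpNorm_two_le_iff]
        calc ∫⁻ x in Ioo (0 : ℝ) 1, ‖(f - g) (x : ℂ)‖ₑ ^ 2
            ≤ ∫⁻ x in Ioo (0 : ℝ) 1, ‖φ (x + Complex.I * δ)‖ₑ ^ 2 := by
              refine lintegral_mono fun x => ?_
              rw [Pi.sub_apply, hfg _ (hreal x)]
              gcongr ?_ ^ 2
              rw [← ofReal_norm, ← ofReal_norm, norm_mul]
              refine ENNReal.ofReal_le_ofReal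
                (mul_le_of_le_one_right (norm_nonneg _) (norm_damping_le_one ?_))
              simp; positivity
          _ ≤ ∫⁻ x in Ioo (-1 : ℝ) 1, ‖φ (x + Complex.I * δ)‖ₑ ^ 2 :=
              lintegral_mono_set (Ioo_subset_Ioo_left (by norm_num))
          _ ≤ _ := hδl.le
      calc l2Norm 0 1 (f - g) / pairNorm h f g ≤ ENNReal.ofReal (2 * ε) / 2 := by gcongr
        _ = ENNReal.ofReal ε := by
            rw [ENNReal.ofReal_mul (by norm_num), ENNReal.ofReal_ofNat, mul_comm,
              ENNReal.mul_div_cancel_right two_ne_zero (by simp)]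
    have hw : ‖f ω₀ - g ω₀‖ₑ / pairNorm h f g ≤ worstError ω₀ h ε :=
      le_iSup₂ (f := fun (p : (ℂ → ℂ) × (ℂ → ℂ)) (_ : p ∈ pairs h ε) =>
        ‖p.1 (ω₀ : ℂ) - p.2 (ω₀ : ℂ)‖ₑ / pairNorm h p.1 p.2) (f, g) hpair
    have hw' : ‖f ω₀ - g ω₀‖ₑ ≤ worstError ω₀ h ε * ENNReal.ofReal 11 := by
      refine ((ENNReal.div_le_iff (by simp) (by simp)).1 (le_trans ?_ hw))
      gcongr
    have hdamp : ‖φ (ω₀ + Complex.I * δ)‖ ≤ (|ω₀| + h + 2) ^ 6 * ‖f ω₀ - g ω₀‖ := by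
      rw [hfg _ (hreal ω₀), norm_mul, norm_damping]
      set w : ℂ := ω₀ + Complex.I * ((h + δ / 2 : ℝ) : ℂ) + Complex.I with hwdef
      have hw1 : ‖w‖ ≤ |ω₀| + h + 2 := by
        have e : w = ω₀ + Complex.I * ((h + δ / 2 + 1 : ℝ) : ℂ) := by
          rw [hwdef]; push_cast; ring
        rw [e]
        refine (norm_add_le _ _).trans ?_
        rw [Complex.norm_real, norm_mul, Complex.norm_I, one_mul, Complex.norm_real,
          Real.norm_eq_abs, Real.norm_of_nonneg (by positivity)]
        linarith
      have hw0 : 0 < ‖w‖ := by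
        refine norm_pos_iff.2 fun h0 => ?_
        have := congrArg Complex.im h0
        simp [hwdef] at this
        linarith
      calc ‖φ (ω₀ + Complex.I * δ)‖ = ‖w‖ ^ 6 * (‖φ (ω₀ + Complex.I * δ)‖ * (‖w‖ ^ 6)⁻¹) := by
            field_simp
        _ ≤ _ := by gcongr
    calc ‖φ (ω₀ + Complex.I * δ)‖ₑ ≤ ENNReal.ofReal ((|ω₀| + h + 2) ^ 6) * ‖f ω₀ - g ω₀‖ₑ := by
          rw [← ofReal_norm, ← ofReal_norm, ← ENNReal.ofReal_mul (by positivity)]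
          exact ENNReal.ofReal_le_ofReal hdamp
      _ ≤ ENNReal.ofReal ((|ω₀| + h + 2) ^ 6) * (worstError ω₀ h ε * ENNReal.ofReal 11) := by
          gcongr
      _ = _ := by
          rw [hc, ENNReal.ofReal_mul (by norm_num)]
          ring
  have hop : IsOpen (halfPlane h) := isOpen_lt continuous_const Complex.continuous_im
  have hca : ContinuousAt φ (ω₀ : ℂ) :=
    hd.continuousOn.continuousAt (hop.mem_nhds (by simpa [halfPlane] using hh))
  have hlim : Tendsto (fun δ : ℝ => ‖φ (ω₀ + Complex.I * δ)‖ₑ) (𝓝[>] 0) (𝓝 ‖φ ω₀‖ₑ) := by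
    refine (continuous_enorm.tendsto _).comp (hca.tendsto.comp ?_)
    have : Tendsto (fun δ : ℝ => (ω₀ : ℂ) + Complex.I * δ) (𝓝 0) (𝓝 (ω₀ + Complex.I * (0 : ℝ))) :=
      Continuous.tendsto (by fun_prop) 0
    simpa using this.mono_left nhdsWithin_le_nhds
  exact le_of_tendsto hlim hkey

end Permittivity

end

theorem theorem5p3 (ω₀ h h' : ℝ) (hω₀ : 1 < ω₀) (hh' : 0 < h') (hlt : h' < h) :
    ∃ C : ℝ≥0, 0 < C ∧ ∀ᶠ ε : ℝ in 𝓝[>] 0,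
      Permittivity.hardyError ω₀ h ε ≤ (C : ℝ≥0∞) * Permittivity.worstError ω₀ h ε ∧
      Permittivity.worstError ω₀ h ε ≤ (C : ℝ≥0∞) * Permittivity.hardyError ω₀ h' ε := by
  obtain ⟨C₁, hC₁, h₁⟩ := Permittivity.hardyError_le_worstError (hh'.trans hlt) ω₀
  obtain ⟨C₂, hC₂, h₂⟩ := Permittivity.worstError_le_hardyError hh' hlt ω₀
  refine ⟨max C₁ C₂, lt_max_of_lt_left hC₁, ?_⟩
  filter_upwards [self_mem_nhdsWithin] with ε hε
  constructor
  · refine (h₁ ε hε).trans ?_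
    gcongr
    exact le_max_left _ _
  · refine (h₂ ε).trans ?_
    gcongr
    exact le_max_right _ _
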